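/- Let $N\ge 1$, let $\Omega\subset\mathbb{R}^N$ be a bounded domain satisfying a uniform exterior sphere condition (there is $r>0$ such that for every $y\in\partial\Omega$ there is $z$ with $|z-y|=r$ and $B_r(z)\cap\Omega=\emptyset$), and let $T>0$. Let $\overline f,\overline g:(\mathbb{R}^N\setminus\Omega)\times[0,T]\to\mathbb{R}$ and $u_0:\overline\Omega\to\mathbb{R}$ be Lipschitz continuous with $u_0(x)=\overline f(x,0)$ for $x\in\partial\Omega$. For $0<\varepsilon<1$ let $(u^\varepsilon,v^\varepsilon)$ be a solution of the dynamic programming principle (DPP), where $B_\varepsilon(x)$ is the open ball: $$ \left\{\begin{array}{ll} u^{\varepsilon}(x,t)=\varepsilon^{2}v^{\varepsilon}(x,t)+(1-\varepsilon^{2})\Big\{\frac12 \sup_{y\in B_\varepsilon(x)}u^{\varepsilon}(y,t-\varepsilon^{2})+\frac12\inf_{y\in B_\varepsilon(x)}u^{\varepsilon}(y,t-\varepsilon^{2})\Big\}, & x\in\Omega,\ t\in(0,T],\\[4pt] v^{\varepsilon}(x,t)=\varepsilon^{2}u^{\varepsilon}(x,t)+(1-\varepsilon^{2})\frac{1}{|B_\varepsilon(x)|}\int_{B_\varepsilon(x)}v^{\varepsilon}(y,t)\,dy,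 & x\in\Omega,\ t\in(0,T],\\[4pt] u^{\varepsilon}(x,t)=\overline f(x,t),\quad v^{\varepsilon}(x,t)=\overline g(x,t), & x\in\mathbb{R}^N\setminus\Omega,\ t\in(0,T],\\[4pt] u^{\varepsilon}(x,t)=u_0(x), & x\in\Omega,\ t\le 0,\\[4pt] u^{\varepsilon}(x,t)=\overline f(x,0), & x\in\mathbb{R}^N\setminus\Omega,\ t\le 0, \end{array}\right. $$ it being part of the notion of solution that the suprema and infima are finite and that $v^\varepsilon(\cdot,t)$ is integrable on the balls $B_\varepsilon(x)$ that occur. Then there are a subsequence $\varepsilon_k\to0$ and a pair of functions $(u,v)$, continuous on $\overline\Omega\times[0,T]$, such that $$u^{\varepsilon_k}\to u \ \text{ uniformly on } \overline\Omega\times[0,T],\qquad v^{\varepsilon_k}\to v\ \text{ uniformly on } \overline\Omega\times(0,T].$$ If moreover $v^\varepsilon(\cdot,0)$, which the DPP leaves free, is chosen for every $\varepsilon$ so that the equation for $v^\varepsilon$ in $\Omega$ (including the integrability on the balls) and the exterior condition $v^\varepsilon=\overline g$ on $\mathbb{R}^N\setminus\Omega$ also hold at $t=0$, then $v^{\varepsilon_k}\to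 v$ uniformly on $\overline\Omega\times[0,T]$. More precisely, every sequence in $(0,1)$ tending to $0$ has such a subsequence (for the last assertion it is enough that these conditions at $t=0$ hold along the given sequence). -/

import Mathlib

open Set Filter Topology MeasureTheory Metric

/-- Uniform exterior sphere condition: there is one radius `r > 0` such that every boundary point
lies on a sphere of radius `r` whose open ball does not meet `Ω`. -/
def UniformExteriorSphere {N : ℕ} (Ω : Set (EuclideanSpace ℝ (Fin N))) : Prop :=
  ∃ r : ℝ, 0 < r ∧ ∀ y ∈ frontier Ω, ∃ z, dist z y = r ∧ Disjoint (ball z r) Ω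

/-- The first-board (Tug-of-War) equation at all points of `Ω × (0,T]`:
`u(x,t) = ε² v(x,t) + (1 - ε²) (½ sup_{B_ε(x)} u(·,t-ε²) + ½ inf_{B_ε(x)} u(·,t-ε²))`,
where the supremum and the infimum are required to be finite. -/
def SolvesFirstBoard {N : ℕ} (Ω : Set (EuclideanSpace ℝ (Fin N))) (T ε : ℝ)
    (u v : EuclideanSpace ℝ (Fin N) → ℝ → ℝ) : Prop :=
  ∀ x ∈ Ω, ∀ t ∈ Ioc 0 T,
    BddAbove ((fun y => u y (t - ε ^ 2)) '' ball x ε) ∧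
    BddBelow ((fun y => u y (t - ε ^ 2)) '' ball x ε) ∧
    u x t = ε ^ 2 * v x t + (1 - ε ^ 2) *
      (1 / 2 * sSup ((fun y => u y (t - ε ^ 2)) '' ball x ε) +
       1 / 2 * sInf ((fun y => u y (t - ε ^ 2)) '' ball x ε))

/-- The second-board (random walk) relations at one fixed time level `t`:
`v(x,t) = ε² u(x,t) + (1 - ε²) ⨍_{B_ε(x)} v(y,t) dy` for `x ∈ Ω`, where `v(·,t)` is required to be
integrable on the ball, and `v(x,t) = g(x,t)` for `x ∉ Ω`. -/
def SolvesSecondBoardAt {N : ℕ} (Ω : Set (EuclideanSpace ℝ (Fin N)))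
    (g : EuclideanSpace ℝ (Fin N) → ℝ → ℝ) (ε : ℝ)
    (u v : EuclideanSpace ℝ (Fin N) → ℝ → ℝ) (t : ℝ) : Prop :=
  (∀ x ∈ Ω, IntegrableOn (fun y => v y t) (ball x ε) ∧
    v x t = ε ^ 2 * u x t + (1 - ε ^ 2) * ⨍ y in ball x ε, v y t) ∧
  (∀ x ∉ Ω, v x t = g x t)

/-- `(u, v)` solves the dynamic programming principle with step `ε`, exterior data `f`, `g` and
initial datum `u₀`. When the time is exhausted the first-board payoff is `u₀(x)` inside `Ω` and
`f(x,0)` outside `Ω`. The values of `v` at times `t ≤ 0` are not prescribed. -/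
structure IsDPPSolution {N : ℕ} (Ω : Set (EuclideanSpace ℝ (Fin N))) (T : ℝ)
    (f g : EuclideanSpace ℝ (Fin N) → ℝ → ℝ) (u₀ : EuclideanSpace ℝ (Fin N) → ℝ) (ε : ℝ)
    (u v : EuclideanSpace ℝ (Fin N) → ℝ → ℝ) : Prop where
  firstBoard : SolvesFirstBoard Ω T ε u v
  secondBoard : ∀ t ∈ Ioc 0 T, SolvesSecondBoardAt Ω g ε u v t
  exterior : ∀ x ∉ Ω, ∀ t ∈ Ioc 0 T, u x t = f x t
  initial : ∀ x ∈ Ω, ∀ t ≤ 0, u x t = u₀ x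
  initial_exterior : ∀ x ∉ Ω, ∀ t ≤ 0, u x t = f x 0

/-!
The solutions of the dynamic programming principle are uniformly bounded and equicontinuous up to an
error that vanishes with `ε`; an Arzelà–Ascoli argument for not necessarily continuous functions
(`exists_subseq_tendstoUniformlyOn`) then gives the subsequence. No game or random walk is used: all
estimates come from comparison principles.

The engine is that both equations commute with translations in space and time. If `(u, v)` is
compared with its translate by `(a, τ)`, the differences at time `t` are controlled by the
differences of `u` at time `t - ε ^ 2` and by the values at pairs of points that do not both lie in
`Ω`. For the second board this is a contraction argument (`le_of_contraction`,
`secondBoard_comparison`): the factor `1 - ε ^ 2` in front of the average is strictly less than one,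
and averages of `v` are finite because `v(·,t)` is integrable over the compact set `closure Ω`. The
first board then follows by induction over the time levels (`IsDPPSolution.abs_translate_sub_le`).
Hence the modulus of continuity is inherited from the lateral and initial data, and it remains to
control the solutions there, by explicit barriers; lower bounds follow by negating the data.

* At an exterior point `y` the first board is bounded by a concave cone with vertex `y` moving
  linearly in time (`IsDPPSolution.le_boundary`). Concavity beats the bounded source, and no
  regularity of the boundary is needed.
* At small times the first board is bounded by an expanding paraboloid
  (`IsDPPSolution.le_initial`).
* At a boundary point the second board is bounded by an inverted Gaussian centred in the exterior
  ball (`SolvesSecondBoardAt.le_frontier`). Its superharmonicity at scale `ε` is the mean value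
  inequality `le_setAverage_exp_neg_sq`, obtained from the isotropy of the second moments of a ball.

The functions `v(·,0)` need not satisfy any equation, so the limit of the `v` is extracted from their
values at the times `max t τ` with `τ > 0` tending to `0` along the sequence.
-/

/-! ### Induction in time and contraction -/

/-- Induction along time levels spaced by `δ`, starting from all nonpositive times. -/
theorem time_induction {δ T : ℝ} (hδ : 0 < δ) {P : ℝ → Prop} (h0 : ∀ t ≤ 0, t ≤ T → P t)
    (hs : ∀ t, 0 < t → t ≤ T → P (t - δ) → P t) : ∀ t ≤ T, P t := by
  have key : ∀ n : ℕ, ∀ t ≤ T, t ≤ n * δ → P t := by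
    intro n
    induction n with
    | zero => intro t hT h; exact h0 t (by simpa using h) hT
    | succ n ih =>
      intro t hT h
      rcases le_or_gt t 0 with h' | h'
      · exact h0 t h' hT
      · refine hs t h' hT (ih _ (by linarith) ?_)
        push_cast at h
        linarith
  intro t ht
  obtain ⟨n, hn⟩ := exists_nat_ge (t / δ)
  exact key n t ht (by rwa [div_le_iff₀ hδ] at hn)

/-- A function bounded above on `G` whose upper bounds `c ≥ β` can all be improved to
`β + θ (c - β)` with a fixed `θ < 1` is at most `β`. -/
theorem le_of_contraction {α : Type*} {G : Set α} {p : α → ℝ} {β θ : ℝ} (hθ : θ < 1)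
    (hbdd : ∃ C, ∀ x ∈ G, p x ≤ C)
    (h : ∀ c, β ≤ c → (∀ x ∈ G, p x ≤ c) → ∀ x ∈ G, p x - β ≤ θ * (c - β)) :
    ∀ x ∈ G, p x ≤ β := by
  obtain ⟨C, hC⟩ := hbdd
  intro x hx
  by_contra hlt
  push Not at hlt
  have hb : BddAbove (p '' G) := ⟨C, by rintro _ ⟨y, hy, rfl⟩; exact hC y hy⟩
  have hle : ∀ y ∈ G, p y ≤ sSup (p '' G) := fun y hy => le_csSup hb ⟨y, hy, rfl⟩
  have hS : β < sSup (p '' G) := hlt.trans_le (hle x hx)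
  have h1 := h _ hS.le hle
  have h2 : sSup (p '' G) ≤ β + θ * (sSup (p '' G) - β) := by
    refine csSup_le ⟨_, x, hx, rfl⟩ ?_
    rintro _ ⟨y, hy, rfl⟩
    linarith [h1 y hy]
  nlinarith

/-! ### Averages, suprema and infima -/

theorem setAverage_mono_of_integrableOn {α : Type*} [MeasurableSpace α] {μ : Measure α} {s : Set α}
    (hs : MeasurableSet s) {f g : α → ℝ} (hf : IntegrableOn f s μ)
    (hg : IntegrableOn g s μ) (h : ∀ x ∈ s, f x ≤ g x) :
    ⨍ x in s, f x ∂μ ≤ ⨍ x in s, g x ∂μ := by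
  rw [setAverage_eq, setAverage_eq]
  exact mul_le_mul_of_nonneg_left (setIntegral_mono_on hf hg hs h) (by positivity)

theorem setAverage_add_const {α : Type*} [MeasurableSpace α] {μ : Measure α} {s : Set α}
    (h0 : μ s ≠ 0) (h1 : μ s ≠ ⊤) {f : α → ℝ} (hf : IntegrableOn f s μ) (c : ℝ) :
    ⨍ x in s, (f x + c) ∂μ = (⨍ x in s, f x ∂μ) + c := by
  have hpos : μ.real s ≠ 0 := by
    rw [measureReal_def]; exact (ENNReal.toReal_ne_zero).2 ⟨h0, h1⟩
  rw [setAverage_eq, setAverage_eq, integral_add hf (integrableOn_const h1)]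
  simp only [smul_eq_mul, integral_const, measureReal_restrict_apply, MeasurableSet.univ, univ_inter]
  field_simp

theorem setAverage_le_add {α : Type*} [MeasurableSpace α] {μ : Measure α} {s : Set α}
    (hs : MeasurableSet s) (h0 : μ s ≠ 0) (h1 : μ s ≠ ⊤) {f g : α → ℝ} (hf : IntegrableOn f s μ)
    (hg : IntegrableOn g s μ) {c : ℝ} (h : ∀ x ∈ s, f x ≤ g x + c) :
    ⨍ x in s, f x ∂μ ≤ (⨍ x in s, g x ∂μ) + c := by
  rw [← setAverage_add_const h0 h1 hg]
  exact setAverage_mono_of_integrableOn hs hf (hg.add (integrableOn_const h1)) h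

theorem abs_setAverage_sub_le {α : Type*} [MeasurableSpace α] {μ : Measure α} {s : Set α}
    (hs : MeasurableSet s) (h0 : μ s ≠ 0) (h1 : μ s ≠ ⊤) {f g : α → ℝ} (hf : IntegrableOn f s μ)
    (hg : IntegrableOn g s μ) {c : ℝ} (h : ∀ x ∈ s, |f x - g x| ≤ c) :
    |(⨍ x in s, f x ∂μ) - ⨍ x in s, g x ∂μ| ≤ c := by
  have h2 := setAverage_le_add hs h0 h1 hf hg (c := c) fun x hx => by
    linarith [(abs_le.1 (h x hx)).2]
  have h3 := setAverage_le_add hs h0 h1 hg hf (c := c) fun x hx => by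
    linarith [(abs_le.1 (h x hx)).1]
  rw [abs_le]; constructor <;> linarith

theorem abs_midrange_sub_le {α : Type*} {s : Set α} (hs : s.Nonempty) {p q : α → ℝ} {c : ℝ}
    (hp : BddAbove (p '' s)) (hp' : BddBelow (p '' s))
    (hq : BddAbove (q '' s)) (hq' : BddBelow (q '' s)) (h : ∀ x ∈ s, |p x - q x| ≤ c) :
    |(1 / 2 * sSup (p '' s) + 1 / 2 * sInf (p '' s)) -
      (1 / 2 * sSup (q '' s) + 1 / 2 * sInf (q '' s))| ≤ c := by
  have key : ∀ p q : α → ℝ, BddBelow (p '' s) → BddAbove (q '' s) →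
      (∀ x ∈ s, |p x - q x| ≤ c) →
      sSup (p '' s) ≤ sSup (q '' s) + c ∧ sInf (p '' s) ≤ sInf (q '' s) + c := by
    intro p q hp' hq h
    constructor
    · refine csSup_le (hs.image p) ?_
      rintro _ ⟨x, hx, rfl⟩
      linarith [(abs_le.1 (h x hx)).2, le_csSup hq ⟨x, hx, rfl⟩]
    · rw [← sub_le_iff_le_add]
      refine le_csInf (hs.image q) ?_
      rintro _ ⟨x, hx, rfl⟩
      linarith [(abs_le.1 (h x hx)).2, csInf_le hp' ⟨x, hx, rfl⟩]
  obtain ⟨h1, h2⟩ := key p q hp' hq h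
  obtain ⟨h3, h4⟩ := key q p hq' hp fun x hx => by rw [abs_sub_comm]; exact h x hx
  rw [abs_le]; constructor <;> linarith

/-! ### Comparison for the second board at a fixed time -/

section Comparison

variable {N : ℕ}

theorem volume_ball_ne_zero (x : EuclideanSpace ℝ (Fin N)) {ε : ℝ} (hε : 0 < ε) :
    volume (ball x ε) ≠ 0 := (measure_ball_pos _ _ hε).ne'

theorem volume_ball_ne_top (x : EuclideanSpace ℝ (Fin N)) (ε : ℝ) :
    volume (ball x ε) ≠ ⊤ := measure_ball_lt_top.ne

/-- Comparison of two solutions of the second-board equation on a set `G`. The differences of the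
source terms may be controlled partly by those of the solutions: `κ = 0` is the case of given
sources, and `κ = ε ^ 2` that of sources coupled through the first-board equation. -/
theorem secondBoard_comparison {ε κ β : ℝ} (hε : ε ∈ Ioo (0 : ℝ) 1) (hκ : κ ∈ Ico (0 : ℝ) 1)
    {G : Set (EuclideanSpace ℝ (Fin N))} {u₁ u₂ v₁ v₂ : EuclideanSpace ℝ (Fin N) → ℝ}
    (h₁ : ∀ x ∈ G, IntegrableOn v₁ (ball x ε) ∧
      v₁ x = ε ^ 2 * u₁ x + (1 - ε ^ 2) * ⨍ y in ball x ε, v₁ y)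
    (h₂ : ∀ x ∈ G, IntegrableOn v₂ (ball x ε) ∧
      v₂ x = ε ^ 2 * u₂ x + (1 - ε ^ 2) * ⨍ y in ball x ε, v₂ y)
    (hu : ∀ x ∈ G, |u₁ x - u₂ x| ≤ κ * |v₁ x - v₂ x| + (1 - κ) * β)
    (hext : ∀ x ∈ G, ∀ y ∈ ball x ε, y ∉ G → |v₁ y - v₂ y| ≤ β)
    (hbdd : ∃ C, ∀ x ∈ G, |v₁ x - v₂ x| ≤ C) :
    ∀ x ∈ G, |v₁ x - v₂ x| ≤ β := by
  obtain ⟨hε0, hε1⟩ := hε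
  obtain ⟨hκ0, hκ1⟩ := hκ
  have hε2 : 0 < ε ^ 2 := by positivity
  have hε3 : ε ^ 2 < 1 := by nlinarith
  have hd : 0 < 1 - ε ^ 2 * κ := by nlinarith
  refine le_of_contraction (θ := (1 - ε ^ 2) / (1 - ε ^ 2 * κ)) ?_ hbdd ?_
  · rw [div_lt_one hd]; nlinarith
  intro c hc hle x hx
  obtain ⟨i₁, e₁⟩ := h₁ x hx
  obtain ⟨i₂, e₂⟩ := h₂ x hx
  have havg : |(⨍ y in ball x ε, v₁ y) - ⨍ y in ball x ε, v₂ y| ≤ c := by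
    refine abs_setAverage_sub_le measurableSet_ball (volume_ball_ne_zero x hε0)
      (volume_ball_ne_top x ε) i₁ i₂ fun y hy => ?_
    by_cases hyG : y ∈ G
    · exact hle y hyG
    · exact (hext x hx y hy hyG).trans hc
  have h3 : |v₁ x - v₂ x| ≤ ε ^ 2 * |u₁ x - u₂ x| + (1 - ε ^ 2) * c := by
    have : v₁ x - v₂ x = ε ^ 2 * (u₁ x - u₂ x) +
        (1 - ε ^ 2) * ((⨍ y in ball x ε, v₁ y) - ⨍ y in ball x ε, v₂ y) := by
      linear_combination e₁ - e₂
    rw [this]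
    refine (abs_add_le _ _).trans ?_
    rw [abs_mul, abs_mul, abs_of_pos hε2, abs_of_pos (by linarith : 0 < 1 - ε ^ 2)]
    gcongr
  have h4 := mul_le_mul_of_nonneg_left (hu x hx) hε2.le
  rw [div_mul_eq_mul_div, le_div_iff₀ hd]
  nlinarith

/-- Comparison with a strict supersolution of the second-board equation. -/
theorem secondBoard_le_supersolution {ε m : ℝ} (hε : ε ∈ Ioo (0 : ℝ) 1)
    {G : Set (EuclideanSpace ℝ (Fin N))} {u v w : EuclideanSpace ℝ (Fin N) → ℝ}
    (hv : ∀ x ∈ G, IntegrableOn v (ball x ε) ∧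
      v x = ε ^ 2 * u x + (1 - ε ^ 2) * ⨍ y in ball x ε, v y)
    (hu : ∀ x ∈ G, u x ≤ m)
    (hw : ∀ x ∈ G, IntegrableOn w (ball x ε) ∧
      ε ^ 2 * m + (1 - ε ^ 2) * ⨍ y in ball x ε, w y ≤ w x)
    (hext : ∀ x ∈ G, ∀ y ∈ ball x ε, y ∉ G → v y ≤ w y)
    (hbdd : ∃ C, ∀ x ∈ G, v x - w x ≤ C) :
    ∀ x ∈ G, v x ≤ w x := by
  obtain ⟨hε0, hε1⟩ := hε
  have hε2 : 0 < ε ^ 2 := by positivity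
  have hε3 : ε ^ 2 < 1 := by nlinarith
  have := le_of_contraction (G := G) (p := fun x => v x - w x) (β := 0) (θ := 1 - ε ^ 2)
    (by linarith) hbdd ?_
  · intro x hx; linarith [this x hx]
  intro c hc hle x hx
  obtain ⟨i₁, e₁⟩ := hv x hx
  obtain ⟨i₂, e₂⟩ := hw x hx
  have havg : (⨍ y in ball x ε, v y) ≤ (⨍ y in ball x ε, w y) + c := by
    refine setAverage_le_add measurableSet_ball (volume_ball_ne_zero x hε0)
      (volume_ball_ne_top x ε) i₁ i₂ fun y hy => ?_
    by_cases hyG : y ∈ G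
    · linarith [hle y hyG]
    · linarith [hext x hx y hy hyG]
  have h4 := mul_le_mul_of_nonneg_left (hu x hx) hε2.le
  have h5 := mul_le_mul_of_nonneg_left havg (by linarith : 0 ≤ 1 - ε ^ 2)
  linarith

theorem setAverage_ball_add (f : EuclideanSpace ℝ (Fin N) → ℝ) (x h : EuclideanSpace ℝ (Fin N))
    (ε : ℝ) : ⨍ y in ball x ε, f (y + h) = ⨍ y in ball (x + h) ε, f y := by
  have hpre : (fun y => y + h) ⁻¹' ball (x + h) ε = ball x ε := by
    ext y; simp [mem_ball]
  have hmp : MeasurePreserving (fun y : EuclideanSpace ℝ (Fin N) => y + h) volume volume :=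
    measurePreserving_add_right _ h
  rw [setAverage_eq, setAverage_eq, ← hpre,
    hmp.setIntegral_preimage_emb (measurableEmbedding_addRight h) f, hpre,
    measureReal_def, measureReal_def, Measure.addHaar_ball_center,
    Measure.addHaar_ball_center volume (x + h)]

theorem integrableOn_ball_add {f : EuclideanSpace ℝ (Fin N) → ℝ} {x h : EuclideanSpace ℝ (Fin N)}
    {ε : ℝ} (hf : IntegrableOn f (ball (x + h) ε)) :
    IntegrableOn (fun y => f (y + h)) (ball x ε) := by
  have hpre : (fun y => y + h) ⁻¹' ball (x + h) ε = ball x ε := by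
    ext y; simp [mem_ball]
  have hmp : MeasurePreserving (fun y : EuclideanSpace ℝ (Fin N) => y + h) volume volume :=
    measurePreserving_add_right _ h
  rw [← hpre]
  exact (hmp.integrableOn_comp_preimage (measurableEmbedding_addRight h)).2 hf

/-- If `v` is integrable on all balls of radius `ε` centred in a bounded set `Ω` and bounded outside
`Ω`, then its averages over these balls are bounded: by compactness `v` is integrable on
`closure Ω`. -/
theorem exists_abs_setAverage_le {Ω : Set (EuclideanSpace ℝ (Fin N))}
    (hΩ : Bornology.IsBounded Ω) {ε M : ℝ} (hε : 0 < ε) {v : EuclideanSpace ℝ (Fin N) → ℝ}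
    (hv : ∀ x ∈ Ω, IntegrableOn v (ball x ε))
    (hM : ∀ x ∈ Ω, ∀ y ∈ ball x ε, y ∉ Ω → |v y| ≤ M) :
    ∃ C, ∀ x ∈ Ω, |⨍ y in ball x ε, v y| ≤ C := by
  have hK : IsCompact (closure Ω) := hΩ.isCompact_closure
  have hint : IntegrableOn v (closure Ω) := by
    refine LocallyIntegrableOn.integrableOn_isCompact (fun x hx => ?_) hK
    obtain ⟨y, hy, hxy⟩ := Metric.mem_closure_iff.1 hx ε hε
    exact ⟨ball y ε, mem_nhdsWithin_of_mem_nhds (isOpen_ball.mem_nhds hxy), hv y hy⟩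
  set J := ∫ y in closure Ω, |v y| with hJ
  refine ⟨(volume.real (ball (0 : EuclideanSpace ℝ (Fin N)) ε))⁻¹ * J + |M|, fun x hx => ?_⟩
  have hM0 : ∀ y ∈ ball x ε, |v y| ≤ (closure Ω).indicator (fun y => |v y|) y + |M| := by
    intro y hy
    by_cases hyΩ : y ∈ closure Ω
    · rw [indicator_of_mem hyΩ]; linarith [abs_nonneg M]
    · rw [indicator_of_notMem hyΩ, zero_add]
      exact (hM x hx y hy fun h => hyΩ (subset_closure h)).trans (le_abs_self M)
  have hind : Integrable ((closure Ω).indicator fun y => |v y|) :=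
    (integrable_indicator_iff isClosed_closure.measurableSet).2 hint.abs
  have h1 : (⨍ y in ball x ε, |v y|) ≤
      (⨍ y in ball x ε, (closure Ω).indicator (fun y => |v y|) y) + |M| :=
    setAverage_le_add measurableSet_ball (volume_ball_ne_zero x hε) (volume_ball_ne_top x ε)
      (hv x hx).abs hind.integrableOn hM0
  have h2 : (∫ y in ball x ε, (closure Ω).indicator (fun y => |v y|) y) ≤ J := by
    rw [hJ, ← integral_indicator isClosed_closure.measurableSet]
    exact setIntegral_le_integral hind
      (Eventually.of_forall fun y => indicator_nonneg (fun _ _ => abs_nonneg _) y)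
  have h3 : |⨍ y in ball x ε, v y| ≤ ⨍ y in ball x ε, |v y| := by
    rw [setAverage_eq, setAverage_eq, smul_eq_mul, smul_eq_mul, abs_mul,
      abs_of_nonneg (by positivity : 0 ≤ (volume.real (ball x ε))⁻¹)]
    exact mul_le_mul_of_nonneg_left (abs_integral_le_integral_abs) (by positivity)
  refine h3.trans (h1.trans ?_)
  gcongr
  rw [setAverage_eq, smul_eq_mul, measureReal_def, measureReal_def, Measure.addHaar_ball_center]
  exact mul_le_mul_of_nonneg_left h2 (by positivity)

end Comparison

section Data

variable {N : ℕ}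

/-- The first-board payoff when the time is exhausted: `u₀` inside `Ω` and `f(·,0)` outside. -/
noncomputable def initialPayoff (Ω : Set (EuclideanSpace ℝ (Fin N)))
    (f : EuclideanSpace ℝ (Fin N) → ℝ → ℝ) (u₀ : EuclideanSpace ℝ (Fin N) → ℝ)
    (x : EuclideanSpace ℝ (Fin N)) : ℝ :=
  open Classical in if x ∈ Ω then u₀ x else f x 0

/-- Quantitative control of the data: a Lipschitz constant `L`, a bound `M` on the part of the
exterior that a step of length less than `1` from `Ω` can reach, and a bound `R` (with a margin `1`)
for distances. The estimates below depend on the data through these constants only, and replacing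
the data by their negatives does not change them. -/
structure DataBounds (Ω : Set (EuclideanSpace ℝ (Fin N))) (T : ℝ)
    (f g : EuclideanSpace ℝ (Fin N) → ℝ → ℝ) (u₀ : EuclideanSpace ℝ (Fin N) → ℝ)
    (L M R : ℝ) : Prop where
  T_nonneg : 0 ≤ T
  L_nonneg : 0 ≤ L
  M_nonneg : 0 ≤ M
  f_lip : ∀ x ∉ Ω, ∀ y ∉ Ω, ∀ s ∈ Icc 0 T, ∀ t ∈ Icc 0 T,
    |f x s - f y t| ≤ L * (dist x y + |s - t|)
  g_lip : ∀ x ∉ Ω, ∀ y ∉ Ω, ∀ s ∈ Icc 0 T, ∀ t ∈ Icc 0 T,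
    |g x s - g y t| ≤ L * (dist x y + |s - t|)
  init_lip : ∀ x y, |initialPayoff Ω f u₀ x - initialPayoff Ω f u₀ y| ≤ L * dist x y
  f_le : ∀ x ∈ thickening 1 Ω, x ∉ Ω → ∀ t ∈ Icc 0 T, |f x t| ≤ M
  g_le : ∀ x ∈ thickening 1 Ω, x ∉ Ω → ∀ t ∈ Icc 0 T, |g x t| ≤ M
  init_le : ∀ x ∈ Ω, |u₀ x| ≤ M
  dist_le : ∀ x ∈ thickening 1 Ω, ∀ y ∈ thickening 1 Ω, dist x y + 1 ≤ R

theorem initialPayoff_neg (Ω : Set (EuclideanSpace ℝ (Fin N)))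
    (f : EuclideanSpace ℝ (Fin N) → ℝ → ℝ) (u₀ : EuclideanSpace ℝ (Fin N) → ℝ)
    (x : EuclideanSpace ℝ (Fin N)) :
    initialPayoff Ω (fun x t => -f x t) (fun x => -u₀ x) x = -initialPayoff Ω f u₀ x := by
  unfold initialPayoff; split_ifs <;> rfl

variable {Ω : Set (EuclideanSpace ℝ (Fin N))} {T : ℝ}
  {f g : EuclideanSpace ℝ (Fin N) → ℝ → ℝ} {u₀ : EuclideanSpace ℝ (Fin N) → ℝ} {L M R : ℝ}

theorem DataBounds.neg (h : DataBounds Ω T f g u₀ L M R) :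
    DataBounds Ω T (fun x t => -f x t) (fun x t => -g x t) (fun x => -u₀ x) L M R where
  T_nonneg := h.T_nonneg
  L_nonneg := h.L_nonneg
  M_nonneg := h.M_nonneg
  f_lip x hx y hy s hs t ht := by
    rw [neg_sub_neg, abs_sub_comm]; exact h.f_lip x hx y hy s hs t ht
  g_lip x hx y hy s hs t ht := by
    rw [neg_sub_neg, abs_sub_comm]; exact h.g_lip x hx y hy s hs t ht
  init_lip _ _ := by
    rw [initialPayoff_neg, initialPayoff_neg, neg_sub_neg, abs_sub_comm]; exact h.init_lip _ _
  f_le x hx hx' t ht := by rw [abs_neg]; exact h.f_le x hx hx' t ht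
  g_le x hx hx' t ht := by rw [abs_neg]; exact h.g_le x hx hx' t ht
  init_le x hx := by rw [abs_neg]; exact h.init_le x hx
  dist_le := h.dist_le

theorem DataBounds.initialPayoff_le (h : DataBounds Ω T f g u₀ L M R)
    {x : EuclideanSpace ℝ (Fin N)} (hx : x ∈ thickening 1 Ω) : |initialPayoff Ω f u₀ x| ≤ M := by
  unfold initialPayoff
  split_ifs with hx'
  · exact h.init_le x hx'
  · exact h.f_le x hx hx' 0 ⟨le_rfl, h.T_nonneg⟩

theorem ball_subset_thickening_one {x : EuclideanSpace ℝ (Fin N)} (hx : x ∈ Ω) {ε : ℝ}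
    (hε : ε ≤ 1) : ball x ε ⊆ thickening 1 Ω := fun _ hy =>
  mem_thickening_iff.2 ⟨x, hx, (mem_ball.1 hy).trans_le hε⟩

theorem image_neg_fun (p : EuclideanSpace ℝ (Fin N) → ℝ) (s : Set (EuclideanSpace ℝ (Fin N))) :
    (fun y => -p y) '' s = -(p '' s) := by
  ext a
  simp only [mem_image, Set.mem_neg]
  constructor
  · rintro ⟨y, hy, rfl⟩; exact ⟨y, hy, by simp⟩
  · rintro ⟨y, hy, h⟩; exact ⟨y, hy, by simp [h]⟩

variable {ε : ℝ} {u v : EuclideanSpace ℝ (Fin N) → ℝ → ℝ}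

theorem SolvesSecondBoardAt.neg {t : ℝ} (h : SolvesSecondBoardAt Ω g ε u v t) :
    SolvesSecondBoardAt Ω (fun x t => -g x t) ε (fun x t => -u x t) (fun x t => -v x t) t := by
  refine ⟨fun x hx => ⟨(h.1 x hx).1.neg, ?_⟩, fun x hx => by simp only [h.2 x hx]⟩
  have := (h.1 x hx).2
  rw [setAverage_eq] at *
  simp only [smul_eq_mul, integral_neg] at *
  linarith

theorem IsDPPSolution.neg (h : IsDPPSolution Ω T f g u₀ ε u v) :
    IsDPPSolution Ω T (fun x t => -f x t) (fun x t => -g x t) (fun x => -u₀ x) ε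
      (fun x t => -u x t) (fun x t => -v x t) where
  firstBoard x hx t ht := by
    obtain ⟨h1, h2, h3⟩ := h.firstBoard x hx t ht
    rw [image_neg_fun (fun y => u y (t - ε ^ 2)), Real.sSup_neg, Real.sInf_neg]
    exact ⟨h2.neg, h1.neg, by simp only [h3]; ring⟩
  secondBoard t ht := (h.secondBoard t ht).neg
  exterior x hx t ht := by simp only [h.exterior x hx t ht]
  initial x hx t ht := by simp only [h.initial x hx t ht]
  initial_exterior x hx t ht := by simp only [h.initial_exterior x hx t ht]

theorem IsDPPSolution.eq_initialPayoff (h : IsDPPSolution Ω T f g u₀ ε u v)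
    (x : EuclideanSpace ℝ (Fin N)) {t : ℝ} (ht : t ≤ 0) : u x t = initialPayoff Ω f u₀ x := by
  unfold initialPayoff
  split_ifs with hx
  · exact h.initial x hx t ht
  · exact h.initial_exterior x hx t ht

theorem IsDPPSolution.eq_exterior (h : IsDPPSolution Ω T f g u₀ ε u v)
    {x : EuclideanSpace ℝ (Fin N)} (hx : x ∉ Ω) {t : ℝ} (ht : t ≤ T) : u x t = f x (max t 0) := by
  rcases le_or_gt t 0 with h0 | h0
  · rw [max_eq_right h0]; exact h.initial_exterior x hx t h0
  · rw [max_eq_left h0.le]; exact h.exterior x hx t ⟨h0, ht⟩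

/-! ### The a priori bound -/

/-- Bound for the second board at one time level. The case `κ = ε ^ 2` arises when the bound for
`u(·,t)` still involves `v(·,t)` through the first-board equation. -/
theorem SolvesSecondBoardAt.abs_le_of_coupled (hd : DataBounds Ω T f g u₀ L M R)
    (hΩ : Bornology.IsBounded Ω) (hε : ε ∈ Ioo (0 : ℝ) 1) {κ t : ℝ} (hκ : κ ∈ Ico (0 : ℝ) 1)
    (ht : t ∈ Icc 0 T) (h : SolvesSecondBoardAt Ω g ε u v t)
    (hu : ∀ x ∈ Ω, |u x t| ≤ κ * |v x t| + (1 - κ) * M) :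
    ∀ x ∈ thickening 1 Ω, |v x t| ≤ M := by
  have hext : ∀ x ∈ Ω, ∀ y ∈ ball x ε, y ∉ Ω → |v y t| ≤ M := fun x hx y hy hy' => by
    rw [h.2 y hy']
    exact hd.g_le y (ball_subset_thickening_one hx hε.2.le hy) hy' t ht
  have hε2 : 0 < ε ^ 2 := pow_pos hε.1 2
  have hε3 : ε ^ 2 < 1 := by nlinarith [hε.1, hε.2]
  have hd' : 0 < 1 - ε ^ 2 * κ := by nlinarith [hκ.1, hκ.2]
  have hin : ∀ x ∈ Ω, |v x t - 0| ≤ M := by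
    refine secondBoard_comparison (u₁ := fun x => u x t) (v₁ := fun x => v x t) (u₂ := 0) (v₂ := 0)
      hε hκ h.1 (fun x _ => ⟨integrableOn_zero, by simp⟩) (fun x hx => by simpa using hu x hx)
      (fun x hx y hy hy' => by simpa using hext x hx y hy hy') ?_
    obtain ⟨C, hC⟩ := exists_abs_setAverage_le hΩ hε.1 (fun x hx => (h.1 x hx).1) hext
    refine ⟨(M + C) / (1 - ε ^ 2 * κ), fun x hx => ?_⟩
    rw [Pi.zero_apply, sub_zero, le_div_iff₀ hd']
    have h1 : |v x t| ≤ ε ^ 2 * |u x t| + (1 - ε ^ 2) * |⨍ y in ball x ε, v y t| := by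
      conv_lhs => rw [(h.1 x hx).2]
      refine (abs_add_le _ _).trans ?_
      rw [abs_mul, abs_mul, abs_of_pos hε2, abs_of_pos (by linarith : 0 < 1 - ε ^ 2)]
    have h2 := mul_le_mul_of_nonneg_left (hu x hx) hε2.le
    have h3 := mul_le_mul_of_nonneg_left (hC x hx) (by linarith : 0 ≤ 1 - ε ^ 2)
    have hC0 : 0 ≤ C := (abs_nonneg _).trans (hC x hx)
    have h4 : ε ^ 2 * ((1 - κ) * M) ≤ M := by
      have : ε ^ 2 * (1 - κ) ≤ 1 := by nlinarith [hκ.1, hκ.2]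
      nlinarith [hd.M_nonneg]
    nlinarith
  intro x hx
  by_cases hx' : x ∈ Ω
  · simpa using hin x hx'
  · rw [h.2 x hx']; exact hd.g_le x hx hx' t ht

theorem SolvesSecondBoardAt.second_abs_le (hd : DataBounds Ω T f g u₀ L M R)
    (hΩ : Bornology.IsBounded Ω) (hε : ε ∈ Ioo (0 : ℝ) 1) {t : ℝ}
    (ht : t ∈ Icc 0 T) (h : SolvesSecondBoardAt Ω g ε u v t) (hu : ∀ x ∈ Ω, |u x t| ≤ M) :
    ∀ x ∈ thickening 1 Ω, |v x t| ≤ M :=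
  h.abs_le_of_coupled hd hΩ hε (κ := 0) ⟨le_rfl, one_pos⟩ ht (by simpa using hu)

theorem IsDPPSolution.first_abs_le (hd : DataBounds Ω T f g u₀ L M R)
    (hΩ : Bornology.IsBounded Ω) (hε : ε ∈ Ioo (0 : ℝ) 1) (h : IsDPPSolution Ω T f g u₀ ε u v) :
    ∀ t ≤ T, ∀ x ∈ thickening 1 Ω, |u x t| ≤ M := by
  have hε2 : 0 < ε ^ 2 := pow_pos hε.1 2
  have hε3 : ε ^ 2 < 1 := by nlinarith [hε.1, hε.2]
  refine time_induction hε2 (fun t ht _ x hx => ?_) fun t ht0 htT ih x hx => ?_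
  · rw [h.eq_initialPayoff x ht]; exact hd.initialPayoff_le hx
  have hcpl : ∀ x ∈ Ω, |u x t| ≤ ε ^ 2 * |v x t| + (1 - ε ^ 2) * M := by
    intro x hx
    obtain ⟨h1, h2, h3⟩ := h.firstBoard x hx t ⟨ht0, htT⟩
    have h4 := abs_midrange_sub_le (s := ball x ε) (nonempty_ball.2 hε.1) (c := M) h1 h2
      (q := fun _ => 0) ⟨0, by rintro _ ⟨_, -, rfl⟩; exact le_rfl⟩
      ⟨0, by rintro _ ⟨_, -, rfl⟩; exact le_rfl⟩ fun y hy => by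
        simpa using ih y (ball_subset_thickening_one hx hε.2.le hy)
    rw [(nonempty_ball.2 hε.1).image_const] at h4
    simp only [csSup_singleton, csInf_singleton, mul_zero, add_zero, sub_zero] at h4
    rw [h3]
    refine (abs_add_le _ _).trans ?_
    rw [abs_mul, abs_mul, abs_of_pos hε2, abs_of_pos (by linarith : 0 < 1 - ε ^ 2)]
    gcongr
  by_cases hx' : x ∈ Ω
  · have hv := (h.secondBoard t ⟨ht0, htT⟩).abs_le_of_coupled hd hΩ hε (κ := ε ^ 2)
      ⟨hε2.le, hε3⟩ ⟨ht0.le, htT⟩ hcpl x hx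
    have := hcpl x hx'
    nlinarith
  · rw [h.eq_exterior hx' htT, max_eq_left ht0.le]
    exact hd.f_le x hx hx' t ⟨ht0.le, htT⟩

theorem IsDPPSolution.second_abs_le (hd : DataBounds Ω T f g u₀ L M R)
    (hΩ : Bornology.IsBounded Ω) (hε : ε ∈ Ioo (0 : ℝ) 1) (h : IsDPPSolution Ω T f g u₀ ε u v)
    {t : ℝ} (ht : t ∈ Ioc 0 T) : ∀ x ∈ thickening 1 Ω, |v x t| ≤ M :=
  (h.secondBoard t ht).second_abs_le hd hΩ hε ⟨ht.1.le, ht.2⟩ fun x hx =>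
    h.first_abs_le hd hΩ hε t ht.2 x (self_subset_thickening one_pos Ω hx)

end Data

section FirstBoardBarriers

variable {N : ℕ} {Ω : Set (EuclideanSpace ℝ (Fin N))} {T : ℝ}
  {f g : EuclideanSpace ℝ (Fin N) → ℝ → ℝ} {u₀ : EuclideanSpace ℝ (Fin N) → ℝ} {L M R : ℝ}
  {ε : ℝ} {u v : EuclideanSpace ℝ (Fin N) → ℝ → ℝ}

/-! ### Boundary and initial estimates for the first board -/

/-- A function lying below a radial profile around `y` has infimum over `ball x ε` at most the value
of the profile at the distance `dist x y - ε`: move from `x` straight towards `y`. -/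
theorem sInf_image_ball_le {w : EuclideanSpace ℝ (Fin N) → ℝ} {x y : EuclideanSpace ℝ (Fin N)}
    (hε : 0 < ε) (hb : BddBelow (w '' ball x ε)) {ψ : ℝ → ℝ} (hψ : Continuous ψ)
    (hxy : ε ≤ dist x y) (h : ∀ y' ∈ ball x ε, w y' ≤ ψ (dist y' y)) :
    sInf (w '' ball x ε) ≤ ψ (dist x y - ε) := by
  have hlim : Tendsto (fun a => ψ (dist x y - a)) (𝓝[<] ε) (𝓝 (ψ (dist x y - ε))) :=
    ((hψ.comp (continuous_const.sub continuous_id)).tendsto ε).mono_left nhdsWithin_le_nhds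
  refine ge_of_tendsto hlim ?_
  filter_upwards [Ioo_mem_nhdsLT hε] with a ha
  have hρ : 0 < dist x y := hε.trans_le hxy
  have hn : ‖x - y‖ = dist x y := (dist_eq_norm x y).symm
  have h1 : dist (x - (a / dist x y) • (x - y)) x = a := by
    rw [dist_eq_norm, sub_sub_cancel_left, norm_neg, norm_smul, hn, Real.norm_eq_abs,
      abs_of_pos (div_pos ha.1 hρ), div_mul_cancel₀ _ hρ.ne']
  have h2 : dist (x - (a / dist x y) • (x - y)) y = dist x y - a := by
    have : x - (a / dist x y) • (x - y) - y = (1 - a / dist x y) • (x - y) := by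
      rw [sub_smul, one_smul]; abel
    rw [dist_eq_norm, this, norm_smul, hn, Real.norm_eq_abs, abs_of_nonneg, sub_mul,
      div_mul_cancel₀ _ hρ.ne', one_mul]
    rw [sub_nonneg, div_le_one hρ]; linarith [ha.2]
  have hmem : x - (a / dist x y) • (x - y) ∈ ball x ε := by rw [mem_ball, h1]; exact ha.2
  refine (csInf_le hb ⟨_, hmem, rfl⟩).trans ?_
  rw [← h2]; exact h _ hmem

theorem IsDPPSolution.le_of_step (h : IsDPPSolution Ω T f g u₀ ε u v) (hε : ε ∈ Ioo (0 : ℝ) 1)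
    {x : EuclideanSpace ℝ (Fin N)} (hx : x ∈ Ω) {s : ℝ} (hs : s ∈ Ioc 0 T) (hv : v x s ≤ M)
    {S I : ℝ} (hS : ∀ y ∈ ball x ε, u y (s - ε ^ 2) ≤ S)
    (hI : sInf ((fun y => u y (s - ε ^ 2)) '' ball x ε) ≤ I) :
    u x s ≤ ε ^ 2 * M + (1 - ε ^ 2) * (1 / 2 * S + 1 / 2 * I) := by
  have hε3 : ε ^ 2 < 1 := by nlinarith [hε.1, hε.2]
  rw [(h.firstBoard x hx s hs).2.2]
  have : sSup ((fun y => u y (s - ε ^ 2)) '' ball x ε) ≤ S :=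
    csSup_le ((nonempty_ball.2 hε.1).image _) (by rintro _ ⟨y, hy, rfl⟩; exact hS y hy)
  gcongr

/-- Closing inequality for the cone barrier away from its vertex, with `a = ε ^ 2`: concavity lowers
the mean of the barrier `X` by `2 (2M + L) a`, which pays for the source and the drift in time. -/
theorem step_far_le {a M L X w : ℝ} (ha : 0 ≤ a) (ha' : a ≤ 1 / 4) (hA : 0 ≤ 2 * M + L)
    (hX : -M ≤ X) (h : w ≤ a * M + (1 - a) * (X - 2 * (2 * M + L) * a)) : w ≤ X - L * a := by
  have h1 : 0 ≤ a * (X + M) := mul_nonneg ha (by linarith)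
  have h2 : 0 ≤ (2 * M + L) * a * (1 / 2 - a) := mul_nonneg (mul_nonneg hA ha) (by linarith)
  nlinarith

/-- Closing inequality for the cone barrier within reach of its vertex, with `a = ε ^ 2` and
`k = K ε`: the extra height `4 k` exceeds the mean over one step by at least `k`. -/
theorem step_near_le {a M L b k w p : ℝ} (ha : 0 ≤ a) (hk : 0 ≤ k)
    (hak : a * (2 * M + L) ≤ k) (hb : -M ≤ b) (hp : 0 ≤ p)
    (h : w ≤ a * M + (1 - a) * (b + 3 * k)) : w ≤ b - L * a + 4 * k + p := by
  have h1 : 0 ≤ a * (b + M) := mul_nonneg ha (by linarith)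
  have h2 : 0 ≤ a * k := mul_nonneg ha hk
  nlinarith

/-- Slope of the barrier for the first board. The coefficient of `R` is four times `2M + L`, so that
the profile `K ρ - 2(2M + L) ρ²` increases with slope at least `L` on `[0, R]`. -/
def boundarySlope (L M R : ℝ) : ℝ := 4 * (2 * M + L) * R + L

/-- One-sided Lipschitz boundary estimate for the first board. The barrier is a concave cone with
vertex `y`, raised by `4Kε` away from the vertex to absorb the steps that can reach `y`. -/
theorem IsDPPSolution.le_boundary (hd : DataBounds Ω T f g u₀ L M R)
    (hΩ : Bornology.IsBounded Ω) (hε : ε ∈ Ioc (0 : ℝ) (1 / 2))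
    (h : IsDPPSolution Ω T f g u₀ ε u v) {y : EuclideanSpace ℝ (Fin N)}
    (hy : y ∈ thickening 1 Ω) (hyΩ : y ∉ Ω) {t : ℝ} (ht : t ∈ Icc 0 T)
    {x : EuclideanSpace ℝ (Fin N)} (hx : x ∈ thickening 1 Ω) :
    u x t ≤ f y t + boundarySlope L M R * (dist x y + 4 * ε) := by
  have hε' : ε ∈ Ioo (0 : ℝ) 1 := ⟨hε.1, by linarith [hε.2]⟩
  have hε0 := hε.1
  have hε2 : 0 < ε ^ 2 := pow_pos hε.1 2
  have hε3 : ε ^ 2 ≤ 1 / 4 := by nlinarith [hε.1, hε.2]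
  have hL := hd.L_nonneg
  have hM := hd.M_nonneg
  have hR : 1 ≤ R := by simpa using hd.dist_le y hy y hy
  set A := 2 * M + L with hA
  have hA0 : 0 ≤ A := by positivity
  set K := boundarySlope L M R with hK
  have hKdef : K = 4 * A * R + L := rfl
  have hK0 : 0 ≤ K := by rw [hKdef]; positivity
  have hKA : A ≤ K := by rw [hKdef]; nlinarith
  set φ : ℝ → ℝ := fun ρ => K * ρ - 2 * A * ρ ^ 2 with hφ
  have hφc : Continuous φ := by fun_prop
  have hmono : ∀ a b, 0 ≤ a → a ≤ b → a + b ≤ 2 * R → φ a ≤ φ b := by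
    intro a b ha hab hbR
    have : φ b - φ a = (b - a) * (4 * A * R + L - 2 * A * (a + b)) := by
      simp only [hφ, hKdef]; ring
    nlinarith [mul_nonneg hA0 (by linarith : 0 ≤ 2 * R - (a + b)),
      mul_nonneg (sub_nonneg.2 hab) (by nlinarith : 0 ≤ 4 * A * R + L - 2 * A * (a + b))]
  have hφL : ∀ ρ, 0 ≤ ρ → ρ ≤ R → L * ρ ≤ φ ρ := by
    intro ρ h0 hR'
    have : φ ρ - L * ρ = 2 * A * ρ * (2 * R - ρ) := by simp only [hφ, hKdef]; ring
    have : 0 ≤ 2 * A * ρ * (2 * R - ρ) := by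
      have : 0 ≤ 2 * R - ρ := by linarith
      positivity
    linarith
  have hφK : ∀ ρ, φ ρ ≤ K * ρ := fun ρ => by simp only [hφ]; nlinarith [sq_nonneg ρ]
  have hdR : ∀ x' ∈ thickening 1 Ω, dist x' y + 1 ≤ R := fun x' hx' => hd.dist_le x' hx' y hy
  have hf0 : -M ≤ f y t := (abs_le.1 (hd.f_le y hy hyΩ t ht)).1
  -- outside `Ω`, hence at the vertex, the barrier needs no extra height
  have key : ∀ s ≤ t, ∀ x' ∈ thickening 1 Ω,
      (x' ≠ y → u x' s ≤ f y t + L * (t - s) + φ (dist x' y) + 4 * K * ε) ∧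
      (x' ∉ Ω → u x' s ≤ f y t + L * (t - s) + φ (dist x' y)) := by
    have hextr : ∀ s ≤ t, ∀ x' ∈ thickening 1 Ω, x' ∉ Ω →
        u x' s ≤ f y t + L * (t - s) + φ (dist x' y) := by
      intro s hs x' hx' hx'Ω
      rw [h.eq_exterior hx'Ω (hs.trans ht.2)]
      have h1 := (abs_le.1 (hd.f_lip x' hx'Ω y hyΩ (max s 0)
        ⟨le_max_right _ _, max_le (hs.trans ht.2) hd.T_nonneg⟩ t ht)).2
      have h2 : |max s 0 - t| ≤ t - s := by
        rw [abs_sub_comm, abs_of_nonneg (sub_nonneg.2 (max_le hs ht.1))]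
        linarith [le_max_left s 0]
      have h3 := mul_le_mul_of_nonneg_left h2 hL
      linarith [hφL (dist x' y) dist_nonneg (by linarith [hdR x' hx'])]
    refine time_induction hε2 (fun s hs _ x' hx' => ?_) fun s hs0 hst ih x' hx' => ?_
    · have h1 : u x' s ≤ f y t + L * (t - s) + φ (dist x' y) := by
        rw [h.eq_initialPayoff x' hs]
        have h1 := (abs_le.1 (hd.init_lip x' y)).2
        have h2 : initialPayoff Ω f u₀ y = f y 0 := by unfold initialPayoff; rw [if_neg hyΩ]
        have h3 := (abs_le.1 (hd.f_lip y hyΩ y hyΩ 0 ⟨le_rfl, hd.T_nonneg⟩ t ht)).2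
        rw [dist_self, zero_sub, abs_neg, abs_of_nonneg ht.1] at h3
        nlinarith [hφL (dist x' y) dist_nonneg (by linarith [hdR x' hx'])]
      exact ⟨fun _ => by nlinarith [mul_nonneg hK0 hε0.le], fun _ => h1⟩
    refine ⟨fun hne => ?_, hextr s hst x' hx'⟩
    by_cases hx'Ω : x' ∈ Ω
    swap
    · nlinarith [mul_nonneg hK0 hε0.le, hextr s hst x' hx' hx'Ω]
    have hsT : s ∈ Ioc 0 T := ⟨hs0, hst.trans ht.2⟩
    have hv := (abs_le.1 (h.second_abs_le hd hΩ hε' hsT x' hx')).2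
    have hsub := ball_subset_thickening_one hx'Ω hε'.2.le
    have hρ0 : 0 ≤ dist x' y := dist_nonneg
    have hρR := hdR x' hx'
    set ρ := dist x' y with hρ
    set b := f y t + L * (t - s) + L * ε ^ 2 with hb
    have hbM : -M ≤ b := by
      have := mul_nonneg hL (sub_nonneg.2 hst)
      nlinarith
    have hφ0 : 0 ≤ φ ρ := (by positivity : 0 ≤ L * ρ).trans (hφL ρ hρ0 (by linarith))
    have hall : ∀ y' ∈ ball x' ε, u y' (s - ε ^ 2) ≤ b + φ (dist y' y) + 4 * K * ε := by
      intro y' hy'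
      by_cases hyy : y' ∈ Ω
      · have := (ih y' (hsub hy')).1 (by rintro rfl; exact hyΩ hyy)
        rw [hb]; linarith
      · have := (ih y' (hsub hy')).2 hyy
        rw [hb]; nlinarith [mul_nonneg hK0 hε0.le]
    have hsup : ∀ y' ∈ ball x' ε, u y' (s - ε ^ 2) ≤ b + φ (ρ + ε) + 4 * K * ε := by
      intro y' hy'
      have h1 : dist y' y ≤ ρ + ε := by
        linarith [dist_triangle y' x' y, mem_ball.1 hy']
      have := hmono _ _ dist_nonneg h1 (by linarith [hdR y' (hsub hy'), hε.2])
      linarith [hall y' hy']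
    have hbdd := (h.firstBoard x' hx'Ω s hsT).2.1
    rcases le_or_gt ε ρ with hερ | hερ
    · have hI := sInf_image_ball_le hε0 hbdd (ψ := fun a => b + φ a + 4 * K * ε) (y := y)
        (by fun_prop) hερ hall
      have h1 := h.le_of_step hε' hx'Ω hsT hv hsup hI
      have h2 : 1 / 2 * (b + φ (ρ + ε) + 4 * K * ε) + 1 / 2 * (b + φ (ρ - ε) + 4 * K * ε)
          = b + φ ρ + 4 * K * ε - 2 * A * ε ^ 2 := by simp only [hφ]; ring
      rw [h2] at h1
      have h3 : 0 ≤ K * ε := by positivity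
      have h4 := step_far_le hε2.le hε3 hA0 (by linarith) h1
      linarith
    · have hyball : y ∈ ball x' ε := by rw [mem_ball, dist_comm]; exact hερ
      have hI : sInf ((fun y => u y (s - ε ^ 2)) '' ball x' ε) ≤ b := by
        refine (csInf_le hbdd ⟨y, hyball, rfl⟩).trans ?_
        have := (ih y hy).2 hyΩ
        simp only [dist_self, hφ] at this
        rw [hb]; simp only; linarith
      have h1 := h.le_of_step hε' hx'Ω hsT hv hsup hI
      have h6 := hφK (ρ + ε)
      have h7 : K * (ρ + ε) ≤ 2 * (K * ε) := by nlinarith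
      have h3 : 0 ≤ K * ε := by positivity
      have h8 : 1 / 2 * (b + φ (ρ + ε) + 4 * K * ε) + 1 / 2 * b ≤ b + 3 * (K * ε) := by linarith
      have h9 := mul_le_mul_of_nonneg_left h8 (by linarith : 0 ≤ 1 - ε ^ 2)
      have h11 : ε ^ 2 * A ≤ K * ε := by
        have : ε ^ 2 * A ≤ ε ^ 2 * K := by gcongr
        nlinarith
      have h12 := step_near_le hε2.le h3 h11 hbM hφ0 (h1.trans (by linarith))
      linarith
  have h1 := key t le_rfl x hx
  have h2 := hφK (dist x y)
  have h3 : 0 ≤ K * ε := by positivity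
  by_cases hxΩ : x ∈ Ω
  · have := h1.1 (by rintro rfl; exact hyΩ hxΩ)
    linarith
  · have := h1.2 hxΩ
    linarith

theorem IsDPPSolution.abs_sub_boundary_le (hd : DataBounds Ω T f g u₀ L M R)
    (hΩ : Bornology.IsBounded Ω) (hε : ε ∈ Ioc (0 : ℝ) (1 / 2))
    (h : IsDPPSolution Ω T f g u₀ ε u v) {y : EuclideanSpace ℝ (Fin N)}
    (hy : y ∈ thickening 1 Ω) (hyΩ : y ∉ Ω) {t : ℝ} (ht : t ∈ Icc 0 T)
    {x : EuclideanSpace ℝ (Fin N)} (hx : x ∈ thickening 1 Ω) :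
    |u x t - f y t| ≤ boundarySlope L M R * (dist x y + 4 * ε) := by
  have h1 := h.le_boundary hd hΩ hε hy hyΩ ht hx
  have h2 := h.neg.le_boundary hd.neg hΩ hε hy hyΩ ht hx
  rw [abs_le]; constructor <;> linarith

/-- Speed of the paraboloid barrier for the first board at small times, with margin `η`. -/
noncomputable def initialSpeed (L M η : ℝ) : ℝ := L ^ 2 / (4 * η) + 4 * M + L

/-- One-sided estimate for the first board at small times. The barrier is an expanding paraboloid
centred at `x₀`. -/
theorem IsDPPSolution.le_initial (hd : DataBounds Ω T f g u₀ L M R)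
    (hΩ : Bornology.IsBounded Ω) (hε : ε ∈ Ioc (0 : ℝ) (1 / 2))
    (h : IsDPPSolution Ω T f g u₀ ε u v) {η : ℝ} (hη : 0 < η) {x₀ : EuclideanSpace ℝ (Fin N)}
    (hx₀ : x₀ ∈ thickening 1 Ω) {t : ℝ} (ht : t ∈ Icc 0 T) :
    u x₀ t ≤ initialPayoff Ω f u₀ x₀ + η + initialSpeed L M η * (t + ε ^ 2) := by
  have hε' : ε ∈ Ioo (0 : ℝ) 1 := ⟨hε.1, by linarith [hε.2]⟩
  have hε0 := hε.1
  have hε2 : 0 < ε ^ 2 := pow_pos hε.1 2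
  have hε3 : ε ^ 2 ≤ 1 / 4 := by nlinarith [hε.1, hε.2]
  have hL := hd.L_nonneg
  have hM := hd.M_nonneg
  set C := L ^ 2 / (4 * η) with hC
  have hC0 : 0 ≤ C := by positivity
  set A := initialSpeed L M η with hA
  have hAdef : A = C + 4 * M + L := rfl
  have hA0 : 0 ≤ A := by rw [hAdef]; positivity
  set U := initialPayoff Ω f u₀ x₀ with hU
  have hU0 : -M ≤ U := (abs_le.1 (hd.initialPayoff_le hx₀)).1
  -- the paraboloid lies above the cone of slope `L`
  have hcone : ∀ ρ : ℝ, L * ρ ≤ η + C * ρ ^ 2 := by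
    intro ρ
    have : η + C * ρ ^ 2 - L * ρ = (2 * η - L * ρ) ^ 2 / (4 * η) := by
      rw [hC]; field_simp; ring
    have : 0 ≤ (2 * η - L * ρ) ^ 2 / (4 * η) := by positivity
    linarith
  have key : ∀ s ≤ T, -ε ^ 2 < s → ∀ x ∈ thickening 1 Ω,
      u x s ≤ U + η + C * dist x x₀ ^ 2 + A * (s + ε ^ 2) := by
    have hinit : ∀ x, initialPayoff Ω f u₀ x ≤ U + η + C * dist x x₀ ^ 2 := fun x => by
      linarith [(abs_le.1 (hd.init_lip x x₀)).2, hcone (dist x x₀)]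
    refine time_induction hε2 (fun s hs _ hs' x hx => ?_) fun s hs0 hsT ih _ x hx => ?_
    · rw [h.eq_initialPayoff x hs]
      linarith [hinit x, mul_nonneg hA0 (by linarith : 0 ≤ s + ε ^ 2)]
    by_cases hxΩ : x ∈ Ω
    swap
    · rw [h.eq_exterior hxΩ hsT, max_eq_left hs0.le]
      have h1 := (abs_le.1 (hd.f_lip x hxΩ x hxΩ s ⟨hs0.le, hsT⟩ 0 ⟨le_rfl, hd.T_nonneg⟩)).2
      rw [dist_self, sub_zero, abs_of_pos hs0, zero_add] at h1
      have h2 : initialPayoff Ω f u₀ x = f x 0 := by unfold initialPayoff; rw [if_neg hxΩ]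
      have h3 := hinit x
      have h4 : L * s ≤ A * (s + ε ^ 2) := by
        have : L ≤ A := by rw [hAdef]; linarith
        nlinarith
      linarith
    have hsub := ball_subset_thickening_one hxΩ hε'.2.le
    have hs : s ∈ Ioc 0 T := ⟨hs0, hsT⟩
    have hv := (abs_le.1 (h.second_abs_le hd hΩ hε' hs x hx)).2
    set ρ := dist x x₀ with hρ
    have hρ0 : 0 ≤ ρ := dist_nonneg
    set b := U + η + A * s with hb
    have hall : ∀ y ∈ ball x ε, u y (s - ε ^ 2) ≤ b + C * dist y x₀ ^ 2 := by
      intro y hy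
      have := ih (by linarith) y (hsub hy)
      rw [hb]; nlinarith
    have hsup : ∀ y ∈ ball x ε, u y (s - ε ^ 2) ≤ b + C * (ρ + ε) ^ 2 := by
      intro y hy
      have h1 : dist y x₀ ≤ ρ + ε := by linarith [dist_triangle y x x₀, mem_ball.1 hy]
      have : C * dist y x₀ ^ 2 ≤ C * (ρ + ε) ^ 2 := by gcongr
      linarith [hall y hy]
    have hbdd := (h.firstBoard x hxΩ s hs).2.1
    have hmid : u x s ≤ ε ^ 2 * M + (1 - ε ^ 2) * (b + C * (ρ ^ 2 + ε ^ 2)) := by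
      rcases le_or_gt ε ρ with hερ | hερ
      · have hI := sInf_image_ball_le hε0 hbdd (ψ := fun a => b + C * a ^ 2) (y := x₀)
          (by fun_prop) hερ hall
        have h1 := h.le_of_step hε' hxΩ hs hv hsup hI
        refine h1.trans (le_of_eq ?_)
        ring
      · have hI : sInf ((fun y => u y (s - ε ^ 2)) '' ball x ε) ≤ b := by
          have hmem : x₀ ∈ ball x ε := by rw [mem_ball, dist_comm]; exact hερ
          refine (csInf_le hbdd ⟨x₀, hmem, rfl⟩).trans ?_
          simpa using hall x₀ hmem
        have h1 := h.le_of_step hε' hxΩ hs hv hsup hI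
        refine h1.trans ?_
        have h2 : 0 ≤ C * (ρ - ε) ^ 2 := by positivity
        have h3 : 1 / 2 * (b + C * (ρ + ε) ^ 2) + 1 / 2 * b ≤ b + C * (ρ ^ 2 + ε ^ 2) := by
          nlinarith
        have := mul_le_mul_of_nonneg_left h3 (by linarith : 0 ≤ 1 - ε ^ 2)
        linarith
    have hbM : -M ≤ b + C * ρ ^ 2 := by
      have : 0 ≤ A * s := by positivity
      have : 0 ≤ C * ρ ^ 2 := by positivity
      rw [hb]; linarith
    have h1 : ε ^ 2 * (M - (b + C * ρ ^ 2)) ≤ ε ^ 2 * (2 * M) :=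
      mul_le_mul_of_nonneg_left (by linarith) hε2.le
    have h2 : 0 ≤ ε ^ 2 * (ε ^ 2 * C) := by positivity
    have h3 : 0 ≤ ε ^ 2 * M := by positivity
    have h4 : 0 ≤ ε ^ 2 * L := by positivity
    have h5 : U + η + C * ρ ^ 2 + A * (s + ε ^ 2) = b + C * ρ ^ 2 + ε ^ 2 * (C + 4 * M + L) := by
      rw [hb, ← hAdef]; ring
    rw [h5]
    nlinarith
  have := key t ht.2 (by linarith [ht.1]) x₀ hx₀
  simpa using this

theorem IsDPPSolution.abs_sub_initial_le (hd : DataBounds Ω T f g u₀ L M R)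
    (hΩ : Bornology.IsBounded Ω) (hε : ε ∈ Ioc (0 : ℝ) (1 / 2))
    (h : IsDPPSolution Ω T f g u₀ ε u v) {η : ℝ} (hη : 0 < η) {x₀ : EuclideanSpace ℝ (Fin N)}
    (hx₀ : x₀ ∈ thickening 1 Ω) {t : ℝ} (ht : t ∈ Icc 0 T) :
    |u x₀ t - initialPayoff Ω f u₀ x₀| ≤ η + initialSpeed L M η * (t + ε ^ 2) := by
  have h1 := h.le_initial hd hΩ hε hη hx₀ ht
  have h2 := h.neg.le_initial hd.neg hΩ hε hη hx₀ ht
  rw [initialPayoff_neg] at h2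
  rw [abs_le]; constructor <;> linarith

end FirstBoardBarriers

section MeanValue

variable {N : ℕ}

/-! ### A mean value inequality for Gaussians -/

theorem Continuous.integrableOn_euclidean_ball {F : EuclideanSpace ℝ (Fin N) → ℝ}
    (hF : Continuous F) (x : EuclideanSpace ℝ (Fin N)) (ε : ℝ) : IntegrableOn F (ball x ε) :=
  (hF.locallyIntegrable.integrableOn_isCompact (isCompact_closedBall x ε)).mono_set
    ball_subset_closedBall

theorem setIntegral_ball_zero_comp (e : EuclideanSpace ℝ (Fin N) ≃ₗᵢ[ℝ] EuclideanSpace ℝ (Fin N))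
    (F : EuclideanSpace ℝ (Fin N) → ℝ) (ε : ℝ) :
    ∫ h in ball 0 ε, F (e h) = ∫ h in ball 0 ε, F h := by
  have hpre : e ⁻¹' ball 0 ε = ball 0 ε := by ext y; simp
  conv_lhs => rw [← hpre]
  exact e.measurePreserving.setIntegral_preimage_emb
    e.toHomeomorph.measurableEmbedding F (ball 0 ε)

/-- Isotropy of the second moments of a centred ball. -/
theorem card_mul_setIntegral_inner_sq (a : EuclideanSpace ℝ (Fin N)) (ε : ℝ) :
    N * ∫ h in ball (0 : EuclideanSpace ℝ (Fin N)) ε, (inner ℝ a h) ^ 2 =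
      ‖a‖ ^ 2 * ∫ h in ball (0 : EuclideanSpace ℝ (Fin N)) ε, ‖h‖ ^ 2 := by
  have hrot : ∀ b : EuclideanSpace ℝ (Fin N), ‖a‖ = ‖b‖ →
      ∫ h in ball (0 : EuclideanSpace ℝ (Fin N)) ε, (inner ℝ a h) ^ 2 =
      ∫ h in ball (0 : EuclideanSpace ℝ (Fin N)) ε, (inner ℝ b h) ^ 2 := by
    intro b hb
    rw [← setIntegral_ball_zero_comp (Submodule.reflection (ℝ ∙ (a - b))ᗮ)
      (fun h => (inner ℝ b h) ^ 2)]
    congr 1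
    ext h
    have h1 := LinearIsometryEquiv.inner_map_map (Submodule.reflection (ℝ ∙ (a - b))ᗮ) a h
    rw [Submodule.reflection_sub hb] at h1
    rw [h1]
  set B := EuclideanSpace.basisFun (Fin N) ℝ
  have h1 : ∀ i, ∫ h in ball (0 : EuclideanSpace ℝ (Fin N)) ε, (inner ℝ a h) ^ 2 =
      ∫ h in ball (0 : EuclideanSpace ℝ (Fin N)) ε, ‖a‖ ^ 2 * (inner ℝ (B i) h) ^ 2 := by
    intro i
    rw [hrot (‖a‖ • B i) (by rw [norm_smul, B.norm_eq_one]; simp)]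
    congr 1
    ext h
    rw [real_inner_smul_left, mul_pow]
  have h2 : (N : ℝ) * ∫ h in ball (0 : EuclideanSpace ℝ (Fin N)) ε, (inner ℝ a h) ^ 2 =
      ∑ i, ∫ h in ball (0 : EuclideanSpace ℝ (Fin N)) ε, ‖a‖ ^ 2 * (inner ℝ (B i) h) ^ 2 := by
    simp_rw [← h1]; simp
  rw [h2, ← integral_finsetSum _ fun i _ =>
    Continuous.integrableOn_euclidean_ball (by fun_prop) 0 ε, ← integral_const_mul]
  congr 1
  ext h
  rw [← Finset.mul_sum, ← B.sum_sq_inner_right h]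

theorem le_setIntegral_norm_sq (hN : 0 < N) {ε : ℝ} (hε : 0 < ε) :
    ε ^ 2 / 8 * volume.real (ball (0 : EuclideanSpace ℝ (Fin N)) ε) ≤
      ∫ h in ball (0 : EuclideanSpace ℝ (Fin N)) ε, ‖h‖ ^ 2 := by
  have hvol : volume.real (ball (0 : EuclideanSpace ℝ (Fin N)) (ε / 2)) ≤
      1 / 2 * volume.real (ball (0 : EuclideanSpace ℝ (Fin N)) ε) := by
    have h1 := Measure.addHaar_ball_mul_of_pos volume (0 : EuclideanSpace ℝ (Fin N))
      (by norm_num : (0 : ℝ) < 1 / 2) ε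
    rw [show ε / 2 = 1 / 2 * ε by ring, measureReal_def, measureReal_def, h1, ENNReal.toReal_mul,
      ENNReal.toReal_ofReal (by positivity), finrank_euclideanSpace_fin]
    gcongr
    calc (1 / 2 : ℝ) ^ N ≤ (1 / 2) ^ 1 :=
          pow_le_pow_of_le_one (by norm_num) (by norm_num) hN
      _ = 1 / 2 := by norm_num
  have hsub : ball (0 : EuclideanSpace ℝ (Fin N)) (ε / 2) ⊆ ball 0 ε :=
    ball_subset_ball (by linarith)
  have hcont : Continuous fun h : EuclideanSpace ℝ (Fin N) => ‖h‖ ^ 2 := by fun_prop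
  -- the shell `ε / 2 ≤ ‖h‖ < ε` carries at least half of the volume
  have hshell : (ε / 2) ^ 2 * volume.real
      (ball (0 : EuclideanSpace ℝ (Fin N)) ε \ ball 0 (ε / 2)) ≤
      ∫ h in ball (0 : EuclideanSpace ℝ (Fin N)) ε \ ball 0 (ε / 2), ‖h‖ ^ 2 := by
    refine setIntegral_ge_of_const_le_real (measurableSet_ball.diff measurableSet_ball) ?_ ?_ ?_
    · exact (measure_mono sdiff_subset).trans_lt measure_ball_lt_top |>.ne
    · intro h hh
      have : ε / 2 ≤ ‖h‖ := by simpa using hh.2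
      gcongr
    · exact (hcont.integrableOn_euclidean_ball 0 ε).mono_set sdiff_subset
  have hmono : ∫ h in ball (0 : EuclideanSpace ℝ (Fin N)) ε \ ball 0 (ε / 2), ‖h‖ ^ 2 ≤
      ∫ h in ball (0 : EuclideanSpace ℝ (Fin N)) ε, ‖h‖ ^ 2 :=
    setIntegral_mono_set (hcont.integrableOn_euclidean_ball 0 ε)
      (Eventually.of_forall fun h => by positivity) sdiff_subset.eventuallyLE
  have hdiff := measureReal_sdiff (μ := volume) hsub measurableSet_ball
  rw [hdiff] at hshell
  nlinarith [sq_nonneg ε]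

theorem one_add_sq_div_two_le_cosh (s : ℝ) : 1 + s ^ 2 / 2 ≤ Real.cosh s := by
  have h1 : Real.cosh s = 1 + 2 * Real.sinh (s / 2) ^ 2 := by
    have := Real.cosh_two_mul (s / 2)
    rw [Real.cosh_sq, mul_div_cancel₀ s two_ne_zero] at this
    rw [this]; ring
  have h2 : (s / 2) ^ 2 ≤ Real.sinh (s / 2) ^ 2 := by
    rcases le_total 0 (s / 2) with h | h
    · have := Real.self_le_sinh_iff.2 h
      gcongr
    · have := Real.sinh_le_self_iff.2 h
      nlinarith
  rw [h1]; linarith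

/-- A Gaussian is strictly submean, with a gain of order `ε ^ 2`, where `ℓ ‖x - z‖ ^ 2 ≥ 2 N`.
Averaging over the steps `h` and `-h` turns the integrand into a hyperbolic cosine, whose quadratic
lower bound wins over the factor `exp (-ℓ ‖h‖ ^ 2)` by isotropy. -/
theorem le_setAverage_exp_neg_sq (hN : 0 < N) {ε ℓ : ℝ} (hε : 0 < ε) (hℓ : 0 < ℓ)
    (hℓε : ℓ * ε ^ 2 ≤ 1 / 2) {x z : EuclideanSpace ℝ (Fin N)} (hxz : 2 * N ≤ ℓ * ‖x - z‖ ^ 2) :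
    Real.exp (-ℓ * ‖x - z‖ ^ 2) * (1 + ℓ * ε ^ 2 / 8) ≤
      ⨍ y in ball x ε, Real.exp (-ℓ * ‖y - z‖ ^ 2) := by
  set a := x - z with ha
  set V := volume.real (ball (0 : EuclideanSpace ℝ (Fin N)) ε) with hV
  have hV0 : 0 < V := by
    rw [hV, measureReal_def]
    exact ENNReal.toReal_pos (volume_ball_ne_zero 0 hε) (volume_ball_ne_top 0 ε)
  have hN' : (0 : ℝ) < N := Nat.cast_pos.2 hN
  set G : EuclideanSpace ℝ (Fin N) → ℝ := fun h => Real.exp (-ℓ * ‖a + h‖ ^ 2) with hG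
  have hGc : Continuous G := by fun_prop
  have hshift : ⨍ y in ball x ε, Real.exp (-ℓ * ‖y - z‖ ^ 2) =
      V⁻¹ * ∫ h in ball (0 : EuclideanSpace ℝ (Fin N)) ε, G h := by
    have := setAverage_ball_add (fun y => Real.exp (-ℓ * ‖y - z‖ ^ 2)) 0 x ε
    rw [zero_add] at this
    rw [← this, setAverage_eq, smul_eq_mul]
    congr 2
    ext h
    rw [hG, ha, show h + x - z = x - z + h by abel]
  have hGn : Continuous fun h => G (-h) := hGc.comp continuous_neg
  have hneg : ∫ h in ball (0 : EuclideanSpace ℝ (Fin N)) ε, G (-h) =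
      ∫ h in ball (0 : EuclideanSpace ℝ (Fin N)) ε, G h :=
    setIntegral_ball_zero_comp (LinearIsometryEquiv.neg ℝ) G ε
  have hsym : 2 * ∫ h in ball (0 : EuclideanSpace ℝ (Fin N)) ε, G h =
      ∫ h in ball (0 : EuclideanSpace ℝ (Fin N)) ε, (G h + G (-h)) := by
    rw [integral_add (hGc.integrableOn_euclidean_ball 0 ε)
      (hGn.integrableOn_euclidean_ball 0 ε), hneg]
    ring
  set E := Real.exp (-ℓ * ‖a‖ ^ 2) with hE
  have hE0 : 0 < E := Real.exp_pos _
  have hpt : ∀ h ∈ ball (0 : EuclideanSpace ℝ (Fin N)) ε,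
      2 * E * (1 + (-ℓ * ‖h‖ ^ 2 + ℓ ^ 2 * (inner ℝ a h) ^ 2)) ≤ G h + G (-h) := by
    intro h hh
    set s := 2 * ℓ * inner ℝ a h with hs
    have h1 : G h + G (-h) = 2 * E * (Real.exp (-ℓ * ‖h‖ ^ 2) * Real.cosh s) := by
      have e1 : G h = E * (Real.exp (-ℓ * ‖h‖ ^ 2) * Real.exp (-s)) := by
        rw [hG, hE, ← Real.exp_add, ← Real.exp_add]
        simp only
        rw [norm_add_sq_real, hs]; congr 1; ring
      have e2 : G (-h) = E * (Real.exp (-ℓ * ‖h‖ ^ 2) * Real.exp s) := by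
        rw [hG, hE, ← Real.exp_add, ← Real.exp_add]
        simp only
        rw [norm_add_sq_real, inner_neg_right, norm_neg, hs]; congr 1; ring
      rw [e1, e2, Real.cosh_eq]; ring
    rw [h1]
    have hn : ‖h‖ < ε := by simpa using hh
    have h2 : ℓ * ‖h‖ ^ 2 ≤ 1 / 2 := by
      have : ‖h‖ ^ 2 ≤ ε ^ 2 := by gcongr
      nlinarith
    have h3 : 1 - ℓ * ‖h‖ ^ 2 ≤ Real.exp (-ℓ * ‖h‖ ^ 2) := by
      have := Real.add_one_le_exp (-ℓ * ‖h‖ ^ 2); linarith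
    have h4 := one_add_sq_div_two_le_cosh s
    have h5 : s ^ 2 / 2 = 2 * (ℓ ^ 2 * (inner ℝ a h) ^ 2) := by rw [hs]; ring
    have h6 : 0 ≤ ℓ ^ 2 * (inner ℝ a h) ^ 2 := by positivity
    have h7 : (1 - ℓ * ‖h‖ ^ 2) * (1 + s ^ 2 / 2) ≤
        Real.exp (-ℓ * ‖h‖ ^ 2) * Real.cosh s :=
      mul_le_mul h3 h4 (by positivity) (Real.exp_pos _).le
    have h8 : 1 + (-ℓ * ‖h‖ ^ 2 + ℓ ^ 2 * (inner ℝ a h) ^ 2) ≤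
        (1 - ℓ * ‖h‖ ^ 2) * (1 + s ^ 2 / 2) := by
      rw [h5]; nlinarith
    have := h8.trans h7
    gcongr
  have hint := setIntegral_mono_on (μ := volume)
    (Continuous.integrableOn_euclidean_ball (by fun_prop) 0 ε)
    ((hGc.integrableOn_euclidean_ball 0 ε).add (hGn.integrableOn_euclidean_ball 0 ε))
    measurableSet_ball hpt
  simp only [Pi.add_apply] at hint
  have hiso := card_mul_setIntegral_inner_sq a ε
  have hm := le_setIntegral_norm_sq hN hε
  set m := ∫ h in ball (0 : EuclideanSpace ℝ (Fin N)) ε, ‖h‖ ^ 2 with hmdef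
  set q := ∫ h in ball (0 : EuclideanSpace ℝ (Fin N)) ε, (inner ℝ a h) ^ 2 with hqdef
  have hcomp : ∫ h in ball (0 : EuclideanSpace ℝ (Fin N)) ε,
      2 * E * (1 + (-ℓ * ‖h‖ ^ 2 + ℓ ^ 2 * (inner ℝ a h) ^ 2)) =
      2 * E * (V + (-ℓ * m + ℓ ^ 2 * q)) := by
    rw [integral_const_mul, integral_add (continuous_const.integrableOn_euclidean_ball 0 ε)
      (Continuous.integrableOn_euclidean_ball (by fun_prop) 0 ε),
      integral_add (Continuous.integrableOn_euclidean_ball (by fun_prop) 0 ε)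
      (Continuous.integrableOn_euclidean_ball (by fun_prop) 0 ε),
      integral_const_mul, integral_const_mul]
    simp only [integral_const, measureReal_restrict_apply, MeasurableSet.univ, univ_inter,
      smul_eq_mul, mul_one, hV, hmdef, hqdef]
  rw [hcomp, ← hsym] at hint
  have hm0 : 0 ≤ m := (by positivity : 0 ≤ ε ^ 2 / 8 * V).trans hm
  have hq : 2 * m ≤ ℓ * q := by
    have h1 : N * (ℓ * q) = ℓ * ‖a‖ ^ 2 * m := by linear_combination ℓ * hiso
    have h2 : 2 * N * m ≤ ℓ * ‖a‖ ^ 2 * m := by gcongr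
    have h3 : (N : ℝ) * (2 * m) ≤ N * (ℓ * q) := by rw [h1]; linarith
    exact le_of_mul_le_mul_left h3 hN'
  rw [hshift, inv_mul_eq_div, le_div_iff₀ hV0]
  have h9 : V + ℓ * (ε ^ 2 / 8 * V) ≤ V + (-ℓ * m + ℓ ^ 2 * q) := by nlinarith
  have h10 := mul_le_mul_of_nonneg_left h9 hE0.le
  linarith

end MeanValue

section SecondBoardBarrier

variable {N : ℕ} {Ω : Set (EuclideanSpace ℝ (Fin N))} {T : ℝ}
  {f g : EuclideanSpace ℝ (Fin N) → ℝ → ℝ} {u₀ : EuclideanSpace ℝ (Fin N) → ℝ} {L M R : ℝ}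
  {ε : ℝ} {u v : EuclideanSpace ℝ (Fin N) → ℝ → ℝ}

/-! ### Boundary estimate for the second board -/

theorem norm_sub_midpoint_sq (x y z : EuclideanSpace ℝ (Fin N)) :
    ‖x - (1 / 2 : ℝ) • (y + z)‖ ^ 2 =
      1 / 2 * dist x y ^ 2 + 1 / 2 * dist x z ^ 2 - 1 / 4 * dist z y ^ 2 := by
  have h1 : x - (1 / 2 : ℝ) • (y + z) = (1 / 2 : ℝ) • ((x - y) + (x - z)) := by module
  have h2 : z - y = (x - y) - (x - z) := by abel
  have h3 := parallelogram_law_with_norm ℝ (x - y) (x - z)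
  rw [h1, norm_smul, dist_eq_norm, dist_eq_norm, dist_eq_norm, h2, mul_pow,
    show ‖(1 / 2 : ℝ)‖ ^ 2 = 1 / 4 by norm_num]
  linarith

/-- Exponent of the barrier at the boundary point `y` with exterior ball centred in `z`: it vanishes
on the sphere around the midpoint of `y` and `z` that passes through both points. -/
noncomputable def sphereGap (y z x : EuclideanSpace ℝ (Fin N)) : ℝ :=
  ‖x - (1 / 2 : ℝ) • (y + z)‖ ^ 2 - dist z y ^ 2 / 4

theorem sphereGap_eq (y z x : EuclideanSpace ℝ (Fin N)) :
    sphereGap y z x = 1 / 2 * dist x y ^ 2 + 1 / 2 * (dist x z ^ 2 - dist z y ^ 2) := by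
  rw [sphereGap, norm_sub_midpoint_sq]; ring

theorem sphereGap_le (y z x : EuclideanSpace ℝ (Fin N)) :
    sphereGap y z x ≤ dist x y ^ 2 + dist z y * dist x y := by
  have h1 : dist x z ≤ dist x y + dist z y := by
    rw [dist_comm z y]; exact dist_triangle _ _ _
  have h2 : dist x z ^ 2 ≤ (dist x y + dist z y) ^ 2 := by gcongr
  rw [sphereGap_eq]; nlinarith

theorem sphereGap_nonneg {y z x : EuclideanSpace ℝ (Fin N)} (h : dist z y ≤ dist x z) :
    0 ≤ sphereGap y z x := by
  have : dist z y ^ 2 ≤ dist x z ^ 2 := by gcongr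
  rw [sphereGap_eq]; nlinarith [sq_nonneg (dist x y)]

theorem continuous_sphereGap (y z : EuclideanSpace ℝ (Fin N)) : Continuous (sphereGap y z) := by
  unfold sphereGap; fun_prop

theorem le_setAverage_exp_neg_sphereGap (hN : 0 < N) {ε l : ℝ} (hε : 0 < ε) (hl : 0 < l)
    (hlε : l * ε ^ 2 ≤ 1 / 2) {x y z : EuclideanSpace ℝ (Fin N)}
    (hlr : 2 * N ≤ l * (dist z y ^ 2 / 4)) (hx : dist z y ≤ dist x z) :
    Real.exp (-(l * sphereGap y z x)) * (1 + l * ε ^ 2 / 8) ≤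
      ⨍ a in ball x ε, Real.exp (-(l * sphereGap y z a)) := by
  have h1 : dist z y ^ 2 / 4 ≤ ‖x - (1 / 2 : ℝ) • (y + z)‖ ^ 2 := by
    have := sphereGap_nonneg hx
    rw [sphereGap] at this; linarith
  have h2 := le_setAverage_exp_neg_sq hN hε hl hlε (x := x) (z := (1 / 2 : ℝ) • (y + z))
    (hlr.trans (by gcongr))
  have hfac : ∀ a, Real.exp (-(l * sphereGap y z a)) = Real.exp (l * (dist z y ^ 2 / 4)) *
      Real.exp (-l * ‖a - (1 / 2 : ℝ) • (y + z)‖ ^ 2) := by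
    intro a
    rw [← Real.exp_add, sphereGap]; congr 1; ring
  simp_rw [hfac]
  have h4 : (⨍ a in ball x ε, Real.exp (l * (dist z y ^ 2 / 4)) *
      Real.exp (-l * ‖a - (1 / 2 : ℝ) • (y + z)‖ ^ 2)) = Real.exp (l * (dist z y ^ 2 / 4)) *
      ⨍ a in ball x ε, Real.exp (-l * ‖a - (1 / 2 : ℝ) • (y + z)‖ ^ 2) := by
    rw [setAverage_eq, setAverage_eq, integral_const_mul, smul_eq_mul, smul_eq_mul]
    ring
  rw [h4, mul_assoc]
  gcongr

/-- An inverted function `C (1 - E) + c` is a strict supersolution of the second-board equation where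
`E` has a gain of order `ε ^ 2` in its mean value inequality. -/
theorem supersolution_of_mean_gain {ε M C c k l : ℝ} (hε : 0 < ε) (hε' : ε ^ 2 ≤ 1 / 4)
    (hM : 0 ≤ M) (hC : 0 ≤ C) (hl : 0 ≤ l) (hkl : 32 * M ≤ C * (k * l)) (hc : -M ≤ c)
    {E : EuclideanSpace ℝ (Fin N) → ℝ} {x : EuclideanSpace ℝ (Fin N)}
    (hE : IntegrableOn E (ball x ε)) (hk : k ≤ E x) (hE1 : E x ≤ 1)
    (hmean : E x * (1 + l * ε ^ 2 / 8) ≤ ⨍ a in ball x ε, E a) :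
    ε ^ 2 * M + (1 - ε ^ 2) * (⨍ a in ball x ε, (C * (1 - E a) + c)) ≤ C * (1 - E x) + c := by
  have hε2 : 0 < ε ^ 2 := pow_pos hε 2
  have hav : (⨍ a in ball x ε, (C * (1 - E a) + c)) = C * (1 - ⨍ a in ball x ε, E a) + c := by
    have e2 := setAverage_add_const (volume_ball_ne_zero x hε) (volume_ball_ne_top x ε)
      (hE.const_mul (-C)) (C + c)
    have e3 : (⨍ a in ball x ε, (C * (1 - E a) + c)) =
        ⨍ a in ball x ε, ((-C) * E a + (C + c)) := by
      congr 1; ext a; ring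
    rw [e3, e2, setAverage_eq, setAverage_eq, integral_const_mul, smul_eq_mul, smul_eq_mul]
    ring
  rw [hav]
  have h1 := mul_le_mul_of_nonneg_left hmean hC
  -- the gain in the mean value inequality beats the source
  have h2 : 4 * M * ε ^ 2 ≤ C * (E x * (l * ε ^ 2 / 8)) := by
    have h3 : C * (k * l) * (ε ^ 2 / 8) ≤ C * (E x * l) * (ε ^ 2 / 8) := by gcongr
    have h4 := mul_le_mul_of_nonneg_right hkl (by positivity : 0 ≤ ε ^ 2 / 8)
    linarith
  have h5 := mul_nonneg hC (sub_nonneg.2 hE1)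
  have h6 : C * (1 - ⨍ a in ball x ε, E a) + c ≤ C * (1 - E x) + c - 4 * M * ε ^ 2 := by
    linarith
  have h7 := mul_le_mul_of_nonneg_left h6 (by linarith : 0 ≤ 1 - ε ^ 2)
  have h9 : 0 ≤ ε ^ 2 * (C * (1 - E x) + c + M) := mul_nonneg hε2.le (by linarith)
  have h10 : 0 ≤ M * ε ^ 2 * (2 - 4 * ε ^ 2) := mul_nonneg (mul_nonneg hM hε2.le) (by linarith)
  linarith

/-- Lower bound for the profile `1 - exp (-s)` of the barrier, allowing for a small negative part of
`s`, which occurs where a step from `Ω` enters the exterior ball. -/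
theorem le_one_sub_exp_neg {s S a b k : ℝ} (hs : s ≤ S) (hk : k = Real.exp (-S)) (hk1 : k ≤ 1)
    (ha : 0 ≤ a) (hb : 0 ≤ b) (hb1 : b ≤ 1) (hab : a - b ≤ s) :
    k * a - 4 * b ≤ 1 - Real.exp (-s) := by
  have hk0 : 0 < k := hk ▸ Real.exp_pos _
  have h1 : s * Real.exp (-s) ≤ 1 - Real.exp (-s) := by
    have h2 := mul_le_mul_of_nonneg_right (Real.add_one_le_exp s) (Real.exp_pos (-s)).le
    rw [← Real.exp_add, add_neg_cancel, Real.exp_zero] at h2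
    linarith
  refine le_trans ?_ h1
  rcases le_or_gt 0 s with h0 | h0
  · have h2 : k ≤ Real.exp (-s) := by rw [hk]; exact Real.exp_le_exp.2 (by linarith)
    have h3 : s * k ≤ s * Real.exp (-s) := mul_le_mul_of_nonneg_left h2 h0
    nlinarith
  · have h2 : Real.exp (-s) ≤ 3 := by
      have h4 : Real.exp (-s) ≤ Real.exp 1 := Real.exp_le_exp.2 (by linarith)
      linarith [Real.exp_one_lt_d9]
    have h3 : s * 3 ≤ s * Real.exp (-s) := mul_le_mul_of_nonpos_left h2 h0.le
    nlinarith

/-- One-sided boundary estimate for the second board. The barrier is an inverted Gaussian centred in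
the midpoint of the boundary point `y` and the centre `z` of the exterior ball. With this choice of
centre it separates `y` quadratically from the other points outside `ball z r`. -/
theorem SolvesSecondBoardAt.le_frontier (hN : 0 < N) {r : ℝ} (hr : 0 < r) {η : ℝ} (hη : 0 < η)
    (hM : 0 ≤ M) (hR : 1 ≤ R) :
    ∃ δ > 0, ∃ ε₀ > 0, ∀ (Ω : Set (EuclideanSpace ℝ (Fin N)))
    (f g : EuclideanSpace ℝ (Fin N) → ℝ → ℝ) (u₀ : EuclideanSpace ℝ (Fin N) → ℝ) (T ε : ℝ)
    (u v : EuclideanSpace ℝ (Fin N) → ℝ → ℝ) (t : ℝ) (y z : EuclideanSpace ℝ (Fin N)),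
    DataBounds Ω T f g u₀ L M R → Bornology.IsBounded Ω → ε ∈ Ioo 0 ε₀ → t ∈ Icc 0 T →
    SolvesSecondBoardAt Ω g ε u v t → (∀ x ∈ Ω, |u x t| ≤ M) → y ∈ thickening 1 Ω → y ∉ Ω →
    dist z y = r → Disjoint (ball z r) Ω → ∀ x ∈ Ω, dist x y ≤ δ → v x t ≤ g y t + η := by
  have hN' : (0 : ℝ) < N := Nat.cast_pos.2 hN
  set l : ℝ := 8 * N / r ^ 2 with hl
  have hl0 : 0 < l := by positivity
  set S : ℝ := l * (R ^ 2 + r * R) with hS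
  have hS0 : 0 ≤ S := by positivity
  -- lower bound for the Gaussian within distance `R` of `y`
  set k : ℝ := Real.exp (-S) with hk
  have hk0 : 0 < k := Real.exp_pos _
  have hk1 : k ≤ 1 := by rw [hk, Real.exp_le_one_iff]; linarith
  -- `C` makes the barrier dominate the cone of slope `L` and the bounded source
  set C : ℝ := (L ^ 2 / (4 * (η / 4)) * 2 + 32 * M) / (k * l) with hC
  have hC0 : 0 ≤ C := by positivity
  have hCkl : C * (k * l) = L ^ 2 / (4 * (η / 4)) * 2 + 32 * M := by
    rw [hC]; field_simp
  refine ⟨min 1 (η / 4 / (C * l * (1 + r) + 1)), by positivity,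
    min (1 / 2) (min r (min (η / 4 / (4 * C * (l * r) + 1)) (min (1 / (2 * l)) (1 / (l * r))))),
    by positivity, ?_⟩
  intro Ω f g u₀ T ε u v t y z hd hΩ hε ht h hu hy hyΩ hzy hdisj x₀ hx₀ hx₀δ
  obtain ⟨hε0, hεlt⟩ := hε
  simp only [lt_min_iff] at hεlt
  obtain ⟨hεh, hεr, hεC, hεl, hεlr⟩ := hεlt
  have hε1 : ε ∈ Ioo (0 : ℝ) 1 := ⟨hε0, by linarith⟩
  have hε2 : 0 < ε ^ 2 := pow_pos hε0 2
  have hε3 : ε ^ 2 ≤ 1 / 4 := by nlinarith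
  rw [lt_div_iff₀ (by positivity)] at hεC hεl hεlr
  have hlε : l * ε ^ 2 ≤ 1 / 2 := by nlinarith
  have hρR : ∀ x ∈ thickening 1 Ω, dist x y ≤ R := fun x hx => by
    linarith [hd.dist_le x hx y hy]
  have hqS : ∀ x ∈ thickening 1 Ω, l * sphereGap y z x ≤ S := by
    intro x hx
    have h1 : dist x y ^ 2 + dist z y * dist x y ≤ R ^ 2 + r * R := by
      have := hρR x hx
      rw [hzy]; gcongr
    have h2 := (sphereGap_le y z x).trans h1
    rw [hS]; gcongr
  have hzΩ : ∀ x ∈ Ω, dist z y ≤ dist x z := fun x hx => by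
    by_contra hlt
    exact Set.disjoint_left.1 hdisj (mem_ball.2 (hzy ▸ not_le.1 hlt)) hx
  have hEc : Continuous fun x => Real.exp (-(l * sphereGap y z x)) :=
    Real.continuous_exp.comp (continuous_const.mul (continuous_sphereGap y z)).neg
  have hg0 : -M ≤ g y t := (abs_le.1 (hd.g_le y hy hyΩ t ht)).1
  have hEΩ : ∀ x ∈ Ω, Real.exp (-(l * sphereGap y z x)) ≤ 1 := fun x hx =>
    Real.exp_le_one_iff.2 (neg_nonpos.2 (mul_nonneg hl0.le (sphereGap_nonneg (hzΩ x hx))))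
  have hlr : 2 * (N : ℝ) ≤ l * (dist z y ^ 2 / 4) := by
    rw [hl, hzy]; field_simp; norm_num
  have hsub : ∀ x ∈ Ω, ball x ε ⊆ thickening 1 Ω := fun x hx =>
    ball_subset_thickening_one hx hε1.2.le
  have hvM := h.second_abs_le hd hΩ hε1 ht hu
  have hmain : v x₀ t ≤ C * (1 - Real.exp (-(l * sphereGap y z x₀))) + (g y t + η / 2) := by
    refine secondBoard_le_supersolution (u := fun x => u x t) (v := fun x => v x t) (m := M)
      (w := fun x => C * (1 - Real.exp (-(l * sphereGap y z x))) + (g y t + η / 2))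
      hε1 h.1 (fun x hx => (abs_le.1 (hu x hx)).2) (fun x hx => ⟨?_, ?_⟩)
      (fun x hx y' hy' hy'Ω => ?_) ⟨M + |g y t + η / 2|, fun x hx => ?_⟩ x₀ hx₀
    · exact Continuous.integrableOn_euclidean_ball (by fun_prop) x ε
    · have hxk : k ≤ Real.exp (-(l * sphereGap y z x)) := Real.exp_le_exp.2
        (neg_le_neg (hqS x (self_subset_thickening one_pos Ω hx)))
      exact supersolution_of_mean_gain hε0 hε3 hM hC0 hl0.le
        (by rw [hCkl]; linarith [(by positivity : 0 ≤ L ^ 2 / (4 * (η / 4)) * 2)]) (by linarith)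
        (hEc.integrableOn_euclidean_ball x ε) hxk (hEΩ x hx)
        (le_setAverage_exp_neg_sphereGap hN hε0 hl0 hlε hlr (hzΩ x hx))
    · have hy'1 := hsub x hx hy'
      rw [h.2 y' hy'Ω]
      have h1 := (abs_le.1 (hd.g_lip y' hy'Ω y hyΩ t ht t ht)).2
      rw [sub_self, abs_zero, add_zero] at h1
      have h2 : r - ε ≤ dist y' z := by
        have := dist_triangle x y' z
        rw [dist_comm x y'] at this
        linarith [hzΩ x hx, mem_ball.1 hy']
      have h3 : (r - ε) ^ 2 ≤ dist y' z ^ 2 := by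
        have : 0 ≤ r - ε := by linarith
        gcongr
      have h4 : l * (1 / 2 * dist y' y ^ 2) - l * r * ε ≤ l * sphereGap y z y' := by
        have h5 : 1 / 2 * dist y' y ^ 2 - r * ε ≤ sphereGap y z y' := by
          rw [sphereGap_eq, hzy]; linarith [sq_nonneg ε]
        have := mul_le_mul_of_nonneg_left h5 hl0.le
        linarith
      have h5 := le_one_sub_exp_neg (hqS y' hy'1) hk hk1 (by positivity)
        (by positivity : 0 ≤ l * r * ε) (by linarith) h4
      have h6 := mul_le_mul_of_nonneg_left h5 hC0
      have h7 : L * dist y' y ≤ η / 4 + L ^ 2 / (4 * (η / 4)) * dist y' y ^ 2 := by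
        have e1 : η / 4 + L ^ 2 / (4 * (η / 4)) * dist y' y ^ 2 - L * dist y' y =
            (2 * (η / 4) - L * dist y' y) ^ 2 / (4 * (η / 4)) := by field_simp; ring
        have : 0 ≤ (2 * (η / 4) - L * dist y' y) ^ 2 / (4 * (η / 4)) := by positivity
        linarith
      have h8 : C * (k * (l * (1 / 2 * dist y' y ^ 2))) =
          L ^ 2 / (4 * (η / 4)) * dist y' y ^ 2 + 16 * M * dist y' y ^ 2 := by
        linear_combination (1 / 2 * dist y' y ^ 2) * hCkl
      have h9 : 0 ≤ 16 * M * dist y' y ^ 2 := by positivity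
      have h10 : C * (4 * (l * r * ε)) ≤ η / 4 := by linarith
      linarith
    · have h1 := (abs_le.1 (hvM x (self_subset_thickening one_pos Ω hx))).2
      have h2 := mul_nonneg hC0 (sub_nonneg.2 (hEΩ x hx))
      have h3 := neg_abs_le (g y t + η / 2)
      linarith
  refine hmain.trans ?_
  have hρ0 : 0 ≤ dist x₀ y := dist_nonneg
  have hρ1 : dist x₀ y ≤ 1 := hx₀δ.trans (min_le_left _ _)
  have hρ2 : dist x₀ y * (C * l * (1 + r) + 1) ≤ η / 4 := by
    have := hx₀δ.trans (min_le_right _ _)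
    rwa [le_div_iff₀ (by positivity)] at this
  have h1 : 1 - Real.exp (-(l * sphereGap y z x₀)) ≤ l * sphereGap y z x₀ := by
    linarith [Real.add_one_le_exp (-(l * sphereGap y z x₀))]
  have h2 : sphereGap y z x₀ ≤ dist x₀ y * (1 + r) := by
    have := sphereGap_le y z x₀
    rw [hzy] at this
    nlinarith
  have h3 : C * (1 - Real.exp (-(l * sphereGap y z x₀))) ≤ C * (l * (dist x₀ y * (1 + r))) := by
    gcongr
    exact h1.trans (by gcongr)
  linarith

theorem exists_mem_frontier_segment {Ω : Set (EuclideanSpace ℝ (Fin N))}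
    {x y : EuclideanSpace ℝ (Fin N)} (hx : x ∈ Ω) (hy : y ∉ Ω) :
    ∃ p ∈ frontier Ω, p ∈ segment ℝ x y := by
  by_contra! hcon
  have hpre : IsPreconnected (segment ℝ x y) := (convex_segment x y).isPreconnected
  have hcov : segment ℝ x y ⊆ interior Ω ∪ (closure Ω)ᶜ := by
    intro p hp
    by_cases h1 : p ∈ closure Ω
    · left
      by_contra h2
      exact hcon p ⟨h1, h2⟩ hp
    · exact Or.inr h1
  have hsub := hpre.subset_left_of_subset_union isOpen_interior isClosed_closure.isOpen_compl
    (disjoint_compl_right_iff_subset.2 (interior_subset.trans subset_closure)) hcov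
    ⟨x, left_mem_segment ℝ x y, (hcov (left_mem_segment ℝ x y)).resolve_right
      fun h => h (subset_closure hx)⟩
  exact hy (interior_subset (hsub (right_mem_segment ℝ x y)))

/-- Two-sided boundary estimate for the second board, uniform over all data with the given bounds. -/
theorem SolvesSecondBoardAt.abs_sub_boundary_le (hN : 0 < N) {η : ℝ} (hη : 0 < η)
    (hΩo : IsOpen Ω) (hΩ : Bornology.IsBounded Ω) (hsph : UniformExteriorSphere Ω)
    (hd : DataBounds Ω T f g u₀ L M R) (hR : 1 ≤ R) : ∃ δ > 0, ∃ ε₀ > 0, ∀ (ε : ℝ)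
    (u v : EuclideanSpace ℝ (Fin N) → ℝ → ℝ) (t : ℝ), ε ∈ Ioo 0 ε₀ → t ∈ Icc 0 T →
    SolvesSecondBoardAt Ω g ε u v t → (∀ x ∈ Ω, |u x t| ≤ M) →
    ∀ x, ∀ y ∉ Ω, dist x y ≤ δ → |v x t - g y t| ≤ η := by
  obtain ⟨r, hr, hsph⟩ := hsph
  obtain ⟨δ, hδ, ε₀, hε₀, H⟩ := SolvesSecondBoardAt.le_frontier hN hr (half_pos hη)
    (L := L) hd.M_nonneg hR
  have hL := hd.L_nonneg
  refine ⟨min δ (η / 2 / (L + 1)), by positivity, ε₀, hε₀, ?_⟩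
  intro ε u v t hε ht h hu x y hy hxy
  have hδ1 := hxy.trans (min_le_left _ _)
  have hδ2 : L * dist x y ≤ η / 2 := by
    have h1 := hxy.trans (min_le_right _ _)
    rw [le_div_iff₀ (by positivity)] at h1
    nlinarith [dist_nonneg (x := x) (y := y)]
  have hlip : ∀ a ∉ Ω, dist a y ≤ dist x y → |g a t - g y t| ≤ η / 2 := by
    intro a ha hle
    have h1 := hd.g_lip a ha y hy t ht t ht
    rw [sub_self, abs_zero, add_zero] at h1
    exact h1.trans ((mul_le_mul_of_nonneg_left hle hL).trans hδ2)
  by_cases hx : x ∈ Ω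
  · obtain ⟨p, hpf, hps⟩ := exists_mem_frontier_segment hx hy
    have hpΩ : p ∉ Ω := fun hp => by
      rw [hΩo.frontier_eq] at hpf; exact hpf.2 hp
    have hpt : p ∈ thickening 1 Ω :=
      closure_subset_thickening one_pos Ω (frontier_subset_closure hpf)
    have hadd := dist_add_dist_of_mem_segment hps
    obtain ⟨z, hz, hdisj⟩ := hsph p hpf
    have hxp : dist x p ≤ δ := by linarith [dist_nonneg (x := p) (y := y)]
    have h1 := H Ω f g u₀ T ε u v t p z hd hΩ hε ht h hu hpt hpΩ hz hdisj x hx hxp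
    have h2 := H Ω _ _ _ T ε _ _ t p z hd.neg hΩ hε ht h.neg (fun x hx => by
      rw [abs_neg]; exact hu x hx) hpt hpΩ hz hdisj x hx hxp
    have h3 := abs_le.1 (hlip p hpΩ (by linarith [dist_nonneg (x := x) (y := p)]))
    rw [abs_le]; constructor <;> linarith
  · rw [h.2 x hx]
    linarith [hlip x hx le_rfl]

end SecondBoardBarrier

section Translation

variable {N : ℕ} {Ω : Set (EuclideanSpace ℝ (Fin N))} {T : ℝ}
  {f g : EuclideanSpace ℝ (Fin N) → ℝ → ℝ} {u₀ : EuclideanSpace ℝ (Fin N) → ℝ} {L M R : ℝ}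
  {ε : ℝ} {u v : EuclideanSpace ℝ (Fin N) → ℝ → ℝ}

/-! ### Comparison with translates in space and time -/

theorem SolvesSecondBoardAt.translate {t : ℝ} (h : SolvesSecondBoardAt Ω g ε u v t)
    {a x : EuclideanSpace ℝ (Fin N)} (hx : x + a ∈ Ω) :
    IntegrableOn (fun y => v (y + a) t) (ball x ε) ∧
      v (x + a) t = ε ^ 2 * u (x + a) t + (1 - ε ^ 2) * ⨍ y in ball x ε, v (y + a) t := by
  obtain ⟨h1, h2⟩ := h.1 _ hx
  exact ⟨integrableOn_ball_add h1, by rw [setAverage_ball_add (fun y => v y t)]; exact h2⟩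

/-- Comparison of `v(·,t)` with the translate `v(· + a, t')`, once the sources are comparable and
the values are comparable at pairs of points that are not both in `Ω`. -/
theorem SolvesSecondBoardAt.abs_translate_sub_le (hd : DataBounds Ω T f g u₀ L M R)
    (hΩ : Bornology.IsBounded Ω) (hε : ε ∈ Ioo (0 : ℝ) 1) {κ t t' β : ℝ}
    (hκ : κ ∈ Ico (0 : ℝ) 1) (ht : t ∈ Icc 0 T) (ht' : t' ∈ Icc 0 T)
    (h : SolvesSecondBoardAt Ω g ε u v t) (h' : SolvesSecondBoardAt Ω g ε u v t')
    (hM : ∀ x ∈ Ω, |u x t| ≤ M) (hM' : ∀ x ∈ Ω, |u x t'| ≤ M) {a : EuclideanSpace ℝ (Fin N)}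
    (hu : ∀ x ∈ Ω, x + a ∈ Ω →
      |u (x + a) t' - u x t| ≤ κ * |v (x + a) t' - v x t| + (1 - κ) * β)
    (hbdry : ∀ x ∈ thickening 1 Ω, x + a ∈ thickening 1 Ω → (x ∉ Ω ∨ x + a ∉ Ω) →
      |v (x + a) t' - v x t| ≤ β) :
    ∀ x ∈ thickening 1 Ω, x + a ∈ thickening 1 Ω → |v (x + a) t' - v x t| ≤ β := by
  have hv := h.second_abs_le hd hΩ hε ht hM
  have hv' := h'.second_abs_le hd hΩ hε ht' hM'
  have hin := secondBoard_comparison (G := {x | x ∈ Ω ∧ x + a ∈ Ω}) (β := β)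
    (u₁ := fun x => u (x + a) t') (v₁ := fun x => v (x + a) t')
    (u₂ := fun x => u x t) (v₂ := fun x => v x t) hε hκ
    (fun x hx => h'.translate hx.2) (fun x hx => h.1 x hx.1) (fun x hx => hu x hx.1 hx.2)
    (fun x hx y hy hyG => ?_) ⟨M + M, fun x hx => ?_⟩
  · intro x hx hx'
    by_cases hG : x ∈ Ω ∧ x + a ∈ Ω
    · exact hin x hG
    · exact hbdry x hx hx' (not_and_or.1 hG)
  · have hya : y + a ∈ ball (x + a) ε := by simpa [mem_ball] using hy
    exact hbdry y (ball_subset_thickening_one hx.1 hε.2.le hy)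
      (ball_subset_thickening_one hx.2 hε.2.le hya) (not_and_or.1 hyG)
  · exact (abs_sub _ _).trans (add_le_add
      (hv' _ (self_subset_thickening one_pos Ω hx.2))
      (hv _ (self_subset_thickening one_pos Ω hx.1)))

/-- Comparison of `u` with a translate in space and time, by induction over the time levels: each
step combines the first-board equation with the comparison for the second board. -/
theorem IsDPPSolution.abs_translate_sub_le (hd : DataBounds Ω T f g u₀ L M R)
    (hΩ : Bornology.IsBounded Ω) (hε : ε ∈ Ioo (0 : ℝ) 1) (h : IsDPPSolution Ω T f g u₀ ε u v)
    {a : EuclideanSpace ℝ (Fin N)} {τ β : ℝ} (hτ : 0 ≤ τ)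
    (hinit : ∀ t ≤ 0, t + τ ≤ T → ∀ x ∈ Ω, x + a ∈ Ω → |u (x + a) (t + τ) - u x t| ≤ β)
    (hbu : ∀ t, t + τ ≤ T → ∀ x ∈ thickening 1 Ω, x + a ∈ thickening 1 Ω →
      (x ∉ Ω ∨ x + a ∉ Ω) → |u (x + a) (t + τ) - u x t| ≤ β)
    (hbv : ∀ t, 0 < t → t + τ ≤ T → ∀ x ∈ thickening 1 Ω, x + a ∈ thickening 1 Ω →
      (x ∉ Ω ∨ x + a ∉ Ω) → |v (x + a) (t + τ) - v x t| ≤ β) :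
    ∀ t, t + τ ≤ T → ∀ x ∈ thickening 1 Ω, x + a ∈ thickening 1 Ω →
      |u (x + a) (t + τ) - u x t| ≤ β := by
  have hε2 : 0 < ε ^ 2 := pow_pos hε.1 2
  have hε3 : ε ^ 2 < 1 := by nlinarith [hε.1, hε.2]
  have key : ∀ t ≤ T - τ, ∀ x ∈ thickening 1 Ω, x + a ∈ thickening 1 Ω →
      |u (x + a) (t + τ) - u x t| ≤ β := by
    refine time_induction hε2 (fun t ht htT x hx hx' => ?_) fun t ht0 htT ih x hx hx' => ?_
    · by_cases hG : x ∈ Ω ∧ x + a ∈ Ω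
      · exact hinit t ht (by linarith) x hG.1 hG.2
      · exact hbu t (by linarith) x hx hx' (not_and_or.1 hG)
    have ht1 : t ∈ Ioc 0 T := ⟨ht0, by linarith⟩
    have ht2 : t + τ ∈ Ioc 0 T := ⟨by linarith, by linarith⟩
    have hcpl : ∀ x ∈ Ω, x + a ∈ Ω → |u (x + a) (t + τ) - u x t| ≤
        ε ^ 2 * |v (x + a) (t + τ) - v x t| + (1 - ε ^ 2) * β := by
      intro x hx hx'
      obtain ⟨b1, b2, e1⟩ := h.firstBoard x hx t ht1
      obtain ⟨c1, c2, e2⟩ := h.firstBoard (x + a) hx' (t + τ) ht2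
      have himg : (fun y => u y (t + τ - ε ^ 2)) '' ball (x + a) ε =
          (fun y => u (y + a) (t + τ - ε ^ 2)) '' ball x ε := by
        have : ball (x + a) ε = (fun y => y + a) '' ball x ε := by simp
        rw [this, image_image]
      rw [himg] at c1 c2 e2
      have h4 := abs_midrange_sub_le (nonempty_ball.2 hε.1) (c := β) c1 c2 b1 b2 fun y hy => by
        have hya : y + a ∈ ball (x + a) ε := by simpa [mem_ball] using hy
        have := ih y (ball_subset_thickening_one hx hε.2.le hy)
          (ball_subset_thickening_one hx' hε.2.le hya)
        rwa [show t - ε ^ 2 + τ = t + τ - ε ^ 2 by ring] at this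
      rw [e2, e1, show ∀ p q p' q' c d : ℝ, c * p + d * p' - (c * q + d * q') =
        c * (p - q) + d * (p' - q') by intros; ring]
      refine (abs_add_le _ _).trans ?_
      rw [abs_mul, abs_mul, abs_of_pos hε2, abs_of_pos (by linarith : 0 < 1 - ε ^ 2)]
      have := mul_le_mul_of_nonneg_left h4 (by linarith : 0 ≤ 1 - ε ^ 2)
      linarith
    by_cases hG : x ∈ Ω ∧ x + a ∈ Ω
    · have hv := (h.secondBoard t ht1).abs_translate_sub_le hd hΩ hε (κ := ε ^ 2) ⟨hε2.le, hε3⟩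
        ⟨ht1.1.le, ht1.2⟩ ⟨ht2.1.le, ht2.2⟩ (h.secondBoard (t + τ) ht2)
        (fun x hx => h.first_abs_le hd hΩ hε t ht1.2 x (self_subset_thickening one_pos Ω hx))
        (fun x hx => h.first_abs_le hd hΩ hε _ ht2.2 x (self_subset_thickening one_pos Ω hx))
        hcpl (hbv t ht0 ht2.2) x hx hx'
      have := hcpl x hG.1 hG.2
      nlinarith
    · exact hbu t ht2.2 x hx hx' (not_and_or.1 hG)
  exact fun t ht => key t (by linarith)

end Translation

section Equicontinuity

variable {N : ℕ} {Ω : Set (EuclideanSpace ℝ (Fin N))} {T : ℝ}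
  {f g : EuclideanSpace ℝ (Fin N) → ℝ → ℝ} {u₀ : EuclideanSpace ℝ (Fin N) → ℝ} {L M R : ℝ}
  {ε : ℝ} {u v : EuclideanSpace ℝ (Fin N) → ℝ → ℝ}

/-! ### Asymptotic equicontinuity -/

theorem IsDPPSolution.abs_sub_exterior_le (hd : DataBounds Ω T f g u₀ L M R)
    (hΩ : Bornology.IsBounded Ω) (hε : ε ∈ Ioc (0 : ℝ) (1 / 2))
    (h : IsDPPSolution Ω T f g u₀ ε u v) {y : EuclideanSpace ℝ (Fin N)}
    (hy : y ∈ thickening 1 Ω) (hyΩ : y ∉ Ω) {t : ℝ} (ht : t ≤ T)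
    {x : EuclideanSpace ℝ (Fin N)} (hx : x ∈ thickening 1 Ω) :
    |u x t - f y (max t 0)| ≤ boundarySlope L M R * (dist x y + 4 * ε) := by
  rcases le_or_gt t 0 with h0 | h0
  · rw [max_eq_right h0, h.eq_initialPayoff x h0, ← h.initial_exterior y hyΩ 0 le_rfl,
      ← h.eq_initialPayoff x le_rfl]
    have := h.abs_sub_boundary_le hd hΩ hε hy hyΩ ⟨le_rfl, hd.T_nonneg⟩ hx
    rwa [h.initial_exterior y hyΩ 0 le_rfl]
  · rw [max_eq_left h0.le]
    exact h.abs_sub_boundary_le hd hΩ hε hy hyΩ ⟨h0.le, ht⟩ hx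

/-- Boundary comparison of `u` with its translates. -/
theorem IsDPPSolution.abs_translate_sub_le_of_exterior (hd : DataBounds Ω T f g u₀ L M R)
    (hΩ : Bornology.IsBounded Ω) (hε : ε ∈ Ioc (0 : ℝ) (1 / 2))
    (h : IsDPPSolution Ω T f g u₀ ε u v) {x x' : EuclideanSpace ℝ (Fin N)}
    (hx : x ∈ thickening 1 Ω) (hx' : x' ∈ thickening 1 Ω) (hout : x ∉ Ω ∨ x' ∉ Ω)
    {t τ : ℝ} (hτ : 0 ≤ τ) (ht : t + τ ≤ T) :
    |u x' (t + τ) - u x t| ≤ boundarySlope L M R * (dist x' x + 4 * ε) + L * τ := by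
  have hT := hd.T_nonneg
  have htT : t ≤ T := by linarith
  have hlip : ∀ y ∉ Ω, |f y (max (t + τ) 0) - f y (max t 0)| ≤ L * τ := by
    intro y hy
    refine (hd.f_lip y hy y hy _ ⟨le_max_right _ _, max_le ht hT⟩ _
      ⟨le_max_right _ _, max_le htT hT⟩).trans ?_
    rw [dist_self, zero_add]
    refine mul_le_mul_of_nonneg_left ?_ hd.L_nonneg
    refine (abs_max_sub_max_le_abs _ _ _).trans ?_
    rw [add_sub_cancel_left, abs_of_nonneg hτ]
  rcases hout with ho | ho
  · have h1 := abs_le.1 (h.abs_sub_exterior_le hd hΩ hε hx ho ht hx')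
    have h2 := abs_le.1 (hlip x ho)
    rw [h.eq_exterior ho htT, abs_le]
    constructor <;> linarith
  · have h1 := abs_le.1 (h.abs_sub_exterior_le hd hΩ hε hx' ho htT hx)
    have h2 := abs_le.1 (hlip x' ho)
    rw [dist_comm] at h1
    rw [h.eq_exterior ho ht, abs_le]
    constructor <;> linarith

/-- Comparison of `u` at small times with the initial payoff at a neighbouring point. -/
theorem IsDPPSolution.abs_translate_sub_le_of_initial (hd : DataBounds Ω T f g u₀ L M R)
    (hΩ : Bornology.IsBounded Ω) (hε : ε ∈ Ioc (0 : ℝ) (1 / 2))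
    (h : IsDPPSolution Ω T f g u₀ ε u v) {η : ℝ} (hη : 0 < η) {x x' : EuclideanSpace ℝ (Fin N)}
    (hx' : x' ∈ thickening 1 Ω) {t τ : ℝ} (ht0 : t ≤ 0) (hτ : 0 ≤ τ) (ht : t + τ ≤ T) :
    |u x' (t + τ) - u x t| ≤ η + initialSpeed L M η * (τ + ε ^ 2) + L * dist x' x := by
  have hA : 0 ≤ initialSpeed L M η := by
    have := hd.L_nonneg
    have := hd.M_nonneg
    unfold initialSpeed; positivity
  have h1 : |u x' (t + τ) - initialPayoff Ω f u₀ x'| ≤ η + initialSpeed L M η * (τ + ε ^ 2) := by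
    rcases le_or_gt (t + τ) 0 with h0 | h0
    · rw [h.eq_initialPayoff x' h0, sub_self, abs_zero]
      positivity
    · refine (h.abs_sub_initial_le hd hΩ hε hη hx' ⟨h0.le, ht⟩).trans ?_
      gcongr
      linarith
  have h2 := hd.init_lip x' x
  rw [h.eq_initialPayoff x ht0]
  exact (abs_sub_le _ _ _).trans (add_le_add h1 h2)

/-- Solutions of the dynamic programming principle are equicontinuous up to an error that vanishes
with the step size. -/
theorem IsDPPSolution.asymptotically_equicontinuous (hN : 0 < N) (hΩo : IsOpen Ω)
    (hΩ : Bornology.IsBounded Ω) (hsph : UniformExteriorSphere Ω)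
    (hd : DataBounds Ω T f g u₀ L M R) (hR : 1 ≤ R) {η : ℝ} (hη : 0 < η) :
    ∃ δ > 0, ∃ ε₀ > 0, ∀ (ε : ℝ) (u v : EuclideanSpace ℝ (Fin N) → ℝ → ℝ), ε ∈ Ioo 0 ε₀ →
      IsDPPSolution Ω T f g u₀ ε u v →
      ∀ x ∈ closure Ω, ∀ x' ∈ closure Ω, ∀ t ∈ Icc 0 T, ∀ t' ∈ Icc 0 T,
        dist x x' ≤ δ → |t - t'| ≤ δ →
        |u x t - u x' t'| ≤ η ∧
        (SolvesSecondBoardAt Ω g ε u v t → SolvesSecondBoardAt Ω g ε u v t' →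
          |v x t - v x' t'| ≤ η) := by
  obtain ⟨δ₁, hδ₁, ε₁, hε₁, Hv⟩ := SolvesSecondBoardAt.abs_sub_boundary_le hN (half_pos hη) hΩo hΩ
    hsph hd hR
  have hL := hd.L_nonneg
  have hM := hd.M_nonneg
  set K := boundarySlope L M R with hK
  have hK0 : 0 ≤ K := by rw [hK, boundarySlope]; positivity
  set A := initialSpeed L M (η / 3) with hA
  have hA0 : 0 ≤ A := by rw [hA, initialSpeed]; positivity
  set P := 5 * K + 2 * A + 2 * L + 1 with hP
  have hP0 : 0 < P := by positivity
  set d := min (η / 3 / P) (min (1 / 2) (min δ₁ ε₁)) with hdef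
  have hd0 : 0 < d := by positivity
  have hdP : d * P ≤ η / 3 := by
    rw [← le_div_iff₀ hP0]; exact min_le_left _ _
  have hd2 : d ≤ 1 / 2 := (min_le_right _ _).trans (min_le_left _ _)
  have hdδ : d ≤ δ₁ := (min_le_right _ _).trans ((min_le_right _ _).trans (min_le_left _ _))
  have hdε : d ≤ ε₁ := (min_le_right _ _).trans ((min_le_right _ _).trans (min_le_right _ _))
  refine ⟨d, hd0, d, hd0, fun ε u v hε h => ?_⟩
  have hε' : ε ∈ Ioc (0 : ℝ) (1 / 2) := ⟨hε.1, by linarith [hε.2]⟩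
  have hε1 : ε ∈ Ioo (0 : ℝ) 1 := ⟨hε.1, by linarith [hε.2]⟩
  have hεv : ε ∈ Ioo 0 ε₁ := ⟨hε.1, by linarith [hε.2]⟩
  have hKd : 0 ≤ K * d := by positivity
  have hAd : 0 ≤ A * d := by positivity
  have hLd : 0 ≤ L * d := by positivity
  have hKε : K * ε ≤ K * d := mul_le_mul_of_nonneg_left hε.2.le hK0
  have hAε : A * ε ^ 2 ≤ A * d := mul_le_mul_of_nonneg_left (by nlinarith [hε.1, hε.2]) hA0
  have hPd : d * P = 5 * (K * d) + 2 * (A * d) + 2 * (L * d) + d := by rw [hP]; ring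
  have hclo := closure_subset_thickening one_pos Ω
  have hsub := self_subset_thickening one_pos Ω
  have huM := h.first_abs_le hd hΩ hε1
  have main : ∀ x ∈ closure Ω, ∀ x' ∈ closure Ω, ∀ t ∈ Icc 0 T, ∀ t' ∈ Icc 0 T,
      dist x x' ≤ d → t ≤ t' → t' - t ≤ d → |u x' t' - u x t| ≤ η ∧
        (SolvesSecondBoardAt Ω g ε u v t → SolvesSecondBoardAt Ω g ε u v t' →
          |v x' t' - v x t| ≤ η) := by
    intro x hx x' hx' t ht t' ht' hxx htt htd
    obtain ⟨a, rfl⟩ : ∃ a, x' = x + a := ⟨x' - x, by abel⟩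
    obtain ⟨τ, rfl⟩ : ∃ τ, t' = t + τ := ⟨t' - t, by ring⟩
    rw [add_sub_cancel_left] at htd
    have hτ : 0 ≤ τ := by linarith
    have hnorm : ‖a‖ ≤ d := by simpa using hxx
    have hda : ∀ y : EuclideanSpace ℝ (Fin N), dist (y + a) y ≤ d := fun y => by simpa using hnorm
    have hLτ : L * τ ≤ L * d := mul_le_mul_of_nonneg_left htd hL
    have hbv : ∀ s ∈ Icc 0 T, s + τ ≤ T → SolvesSecondBoardAt Ω g ε u v s →
        SolvesSecondBoardAt Ω g ε u v (s + τ) → ∀ y ∈ thickening 1 Ω, y + a ∈ thickening 1 Ω →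
        (y ∉ Ω ∨ y + a ∉ Ω) → |v (y + a) (s + τ) - v y s| ≤ η := by
      intro s hs hsT h1 h2 y hy hya ho
      have hs' : s + τ ∈ Icc 0 T := ⟨by linarith [hs.1], hsT⟩
      have hlip : ∀ z ∉ Ω, |g z (s + τ) - g z s| ≤ L * d := by
        intro z hz
        have := hd.g_lip z hz z hz _ hs' s hs
        rw [dist_self, zero_add, add_sub_cancel_left, abs_of_nonneg hτ] at this
        linarith
      rcases ho with ho | ho
      · have h3 := abs_le.1 (Hv ε u v (s + τ) hεv hs' h2
          (fun z hz => huM _ hsT z (hsub hz)) (y + a) y ho ((hda y).trans hdδ))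
        have h4 := abs_le.1 (hlip y ho)
        rw [h1.2 y ho, abs_le]; constructor <;> linarith
      · have h3 := abs_le.1 (Hv ε u v s hεv hs h1
          (fun z hz => huM _ hs.2 z (hsub hz)) y (y + a) ho (by
            rw [dist_comm]; exact (hda y).trans hdδ))
        have h4 := abs_le.1 (hlip _ ho)
        rw [h2.2 _ ho, abs_le]; constructor <;> linarith
    have hu : ∀ s, s + τ ≤ T → ∀ y ∈ thickening 1 Ω, y + a ∈ thickening 1 Ω →
        |u (y + a) (s + τ) - u y s| ≤ η := by
      refine h.abs_translate_sub_le hd hΩ hε1 hτ (fun s hs hsT y hy hya => ?_)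
        (fun s hsT y hy hya ho => ?_) (fun s hs hsT => ?_)
      · have h1 := h.abs_translate_sub_le_of_initial hd hΩ hε' (by positivity : 0 < η / 3)
          (x := y) (hsub hya) hs hτ hsT
        have h2 : A * τ ≤ A * d := mul_le_mul_of_nonneg_left htd hA0
        have h3 := mul_le_mul_of_nonneg_left (hda y) hL
        rw [← hA] at h1
        linarith
      · have h1 := h.abs_translate_sub_le_of_exterior hd hΩ hε' hy hya ho hτ hsT
        have h3 := mul_le_mul_of_nonneg_left (hda y) hK0
        rw [← hK] at h1
        linarith
      · exact hbv s ⟨hs.le, by linarith⟩ hsT (h.secondBoard s ⟨hs, by linarith⟩)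
          (h.secondBoard (s + τ) ⟨by linarith, hsT⟩)
    refine ⟨hu t ht'.2 x (hclo hx) (hclo hx'), fun h1 h2 => ?_⟩
    exact h1.abs_translate_sub_le hd hΩ hε1 (κ := 0) ⟨le_rfl, one_pos⟩ ht ht' h2
      (fun z hz => huM _ ht.2 z (hsub hz)) (fun z hz => huM _ ht'.2 z (hsub hz))
      (fun y hy hya => by simpa using hu t ht'.2 y (hsub hy) (hsub hya))
      (hbv t ht ht'.2 h1 h2) x (hclo hx) (hclo hx')
  intro x hx x' hx' t ht t' ht' hxx htt
  have htt' := abs_le.1 htt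
  rcases le_total t t' with hle | hle
  · obtain ⟨h1, h2⟩ := main x hx x' hx' t ht t' ht' hxx hle (by linarith)
    rw [abs_sub_comm]
    exact ⟨h1, fun a b => by rw [abs_sub_comm]; exact h2 a b⟩
  · obtain ⟨h1, h2⟩ := main x' hx' x hx t' ht' t ht (by rw [dist_comm]; exact hxx) hle (by linarith)
    exact ⟨h1, fun a b => h2 b a⟩

end Equicontinuity

/-! ### Compactness -/

/-- Arzelà–Ascoli for bounded sequences of functions, not necessarily continuous, that are
equicontinuous up to an error vanishing along the sequence. -/
theorem exists_subseq_tendstoUniformlyOn {X : Type*} [PseudoMetricSpace X] {S : Set X}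
    (hS : IsCompact S) {F : ℕ → X → ℝ} {M : ℝ} (hb : ∀ n, ∀ p ∈ S, |F n p| ≤ M)
    (heq : ∀ η > 0, ∃ δ > 0, ∃ n₀, ∀ n ≥ n₀, ∀ p ∈ S, ∀ q ∈ S, dist p q < δ →
      |F n p - F n q| ≤ η) :
    ∃ φ : ℕ → ℕ, StrictMono φ ∧ ∃ G : X → ℝ, ContinuousOn G S ∧
      TendstoUniformlyOn (fun k => F (φ k)) G atTop S := by
  obtain ⟨D, hDS, hDc, hD⟩ := hS.isSeparable.exists_countable_dense_subset
  have := hDc.to_subtype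
  obtain ⟨G₀, -, φ, hφ, hlim⟩ := (isCompact_univ_pi (fun _ : D => isCompact_Icc (a := -M)
    (b := M))).tendsto_subseq (x := fun n (d : D) => F n d)
    fun n d _ => abs_le.1 (hb n d (hDS d.2))
  rw [tendsto_pi_nhds] at hlim
  have hcau : UniformCauchySeqOn (fun k => F (φ k)) atTop S := by
    rw [Metric.uniformCauchySeqOn_iff]
    intro η hη
    obtain ⟨δ, hδ, n₀, hn₀⟩ := heq (η / 4) (by positivity)
    obtain ⟨D', hD'D, hD'f, hcov⟩ := hS.elim_finite_subcover_image (b := D)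
      (c := fun d => ball d δ) (fun _ _ => isOpen_ball) fun p hp => by
        obtain ⟨d, hd, hpd⟩ := Metric.mem_closure_iff.1 (hD hp) δ hδ
        exact mem_iUnion₂.2 ⟨d, hd, hpd⟩
    have hev : ∃ K, ∀ k ≥ K, ∀ d ∈ D', ∀ l ≥ K, |F (φ k) d - F (φ l) d| ≤ η / 4 := by
      have h1 : ∀ᶠ m in atTop, ∀ d ∈ D', ∀ k ≥ m, ∀ l ≥ m, |F (φ k) d - F (φ l) d| ≤ η / 4 := by
        rw [Filter.eventually_all_finite hD'f]
        intro d hd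
        obtain ⟨m, hm⟩ := Metric.cauchySeq_iff.1 (hlim ⟨d, hD'D hd⟩).cauchySeq (η / 4)
          (by positivity)
        filter_upwards [eventually_ge_atTop m] with m' hm' k hk l hl
        have := hm k (hm'.trans hk) l (hm'.trans hl)
        rw [Real.dist_eq] at this
        exact this.le
      obtain ⟨K, hK⟩ := h1.exists
      exact ⟨K, fun k hk d hd l hl => hK d hd k hk l hl⟩
    obtain ⟨K, hK⟩ := hev
    refine ⟨max K n₀, fun k hk l hl p hp => ?_⟩
    obtain ⟨d, hd, hpd⟩ := mem_iUnion₂.1 (hcov hp)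
    have hk' : n₀ ≤ φ k := ((le_max_right _ _).trans hk).trans (hφ.id_le k)
    have hl' : n₀ ≤ φ l := ((le_max_right _ _).trans hl).trans (hφ.id_le l)
    have h1 := hn₀ _ hk' p hp d (hDS (hD'D hd)) hpd
    have h2 := hn₀ _ hl' p hp d (hDS (hD'D hd)) hpd
    have h3 := hK k ((le_max_left _ _).trans hk) d hd l ((le_max_left _ _).trans hl)
    rw [Real.dist_eq, abs_lt]
    rw [abs_le] at h1 h2 h3
    constructor <;> linarith
  have hpt : ∀ p, ∃ c, p ∈ S → Tendsto (fun k => F (φ k) p) atTop (𝓝 c) := by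
    intro p
    by_cases hp : p ∈ S
    · obtain ⟨c, hc⟩ := cauchySeq_tendsto_of_complete (hcau.cauchySeq hp)
      exact ⟨c, fun _ => hc⟩
    · exact ⟨0, fun h => absurd h hp⟩
  choose G hG using hpt
  refine ⟨φ, hφ, G, ?_, hcau.tendstoUniformlyOn_of_tendsto hG⟩
  rw [Metric.continuousOn_iff]
  intro p hp η hη
  obtain ⟨δ, hδ, n₀, hn₀⟩ := heq (η / 2) (by positivity)
  refine ⟨δ, hδ, fun q hq hqp => ?_⟩
  have h1 : |G q - G p| ≤ η / 2 := by
    refine le_of_tendsto ((hG q hq).sub (hG p hp)).abs ?_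
    filter_upwards [eventually_ge_atTop n₀] with k hk
    exact hn₀ _ (hk.trans (hφ.id_le k)) q hq p hp hqp
  rw [Real.dist_eq]
  linarith

/-! ### Bounds for the data and convergence -/

section Main

variable {N : ℕ} {Ω : Set (EuclideanSpace ℝ (Fin N))} {T : ℝ}
  {f g : EuclideanSpace ℝ (Fin N) → ℝ → ℝ} {u₀ : EuclideanSpace ℝ (Fin N) → ℝ}

theorem LipschitzOnWith.abs_uncurry_sub_le {A : Set (EuclideanSpace ℝ (Fin N))} {K : NNReal}
    (hf : LipschitzOnWith K (fun p : EuclideanSpace ℝ (Fin N) × ℝ => f p.1 p.2) (A ×ˢ Icc 0 T))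
    {L : ℝ} (hL : K ≤ L) {x y : EuclideanSpace ℝ (Fin N)} (hx : x ∈ A) (hy : y ∈ A)
    {s t : ℝ} (hs : s ∈ Icc 0 T) (ht : t ∈ Icc 0 T) :
    |f x s - f y t| ≤ L * (dist x y + |s - t|) := by
  have h1 := hf.dist_le_mul (x, s) ⟨hx, hs⟩ (y, t) ⟨hy, ht⟩
  rw [Real.dist_eq, Prod.dist_eq, Real.dist_eq] at h1
  refine h1.trans (mul_le_mul hL (max_le ?_ ?_) (by positivity) (K.coe_nonneg.trans hL))
  · linarith [abs_nonneg (s - t)]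
  · linarith [dist_nonneg (x := x) (y := y)]

theorem LipschitzOnWith.exists_norm_le_real {X : Type*} [PseudoMetricSpace X] {h : X → ℝ}
    {A : Set X} {K : NNReal} (hh : LipschitzOnWith K h A) (hA : Bornology.IsBounded A) :
    ∃ M, ∀ x ∈ A, |h x| ≤ M := by
  obtain ⟨h', hlip, heq⟩ := hh.extend_real
  obtain ⟨M, hM⟩ := (hlip.isBounded_image hA).exists_norm_le
  exact ⟨M, fun x hx => by rw [heq hx]; exact hM _ ⟨x, hx, rfl⟩⟩

theorem exists_abs_uncurry_le {A B : Set (EuclideanSpace ℝ (Fin N))} {K : NNReal}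
    (hf : LipschitzOnWith K (fun p : EuclideanSpace ℝ (Fin N) × ℝ => f p.1 p.2) (A ×ˢ Icc 0 T))
    (hB : Bornology.IsBounded B) :
    ∃ M, ∀ x ∈ B, x ∈ A → ∀ t ∈ Icc 0 T, |f x t| ≤ M := by
  have h1 : Bornology.IsBounded ((B ∩ A) ×ˢ Icc 0 T) :=
    (hB.subset inter_subset_left).prod (isBounded_Icc 0 T)
  obtain ⟨M, hM⟩ := LipschitzOnWith.exists_norm_le_real
    (hf.mono (prod_mono_left inter_subset_right)) h1
  exact ⟨M, fun x hx hx' t ht => hM (x, t) ⟨⟨hx, hx'⟩, ht⟩⟩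

/-- Lipschitz data have a Lipschitz constant and a bound in the sense of `DataBounds`; the initial
payoff is Lipschitz across the boundary because a segment leaving `Ω` meets the frontier. -/
theorem exists_dataBounds (hΩo : IsOpen Ω) (hΩ : Bornology.IsBounded Ω) (hT : 0 ≤ T)
    (hf : ∃ K, LipschitzOnWith K (fun p : EuclideanSpace ℝ (Fin N) × ℝ => f p.1 p.2)
      (Ωᶜ ×ˢ Icc 0 T))
    (hg : ∃ K, LipschitzOnWith K (fun p : EuclideanSpace ℝ (Fin N) × ℝ => g p.1 p.2)
      (Ωᶜ ×ˢ Icc 0 T))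
    (hu₀ : ∃ K, LipschitzOnWith K u₀ (closure Ω))
    (hcompat : ∀ x ∈ frontier Ω, u₀ x = f x 0) :
    ∃ L M R, 1 ≤ R ∧ DataBounds Ω T f g u₀ L M R := by
  obtain ⟨Kf, hf⟩ := hf
  obtain ⟨Kg, hg⟩ := hg
  obtain ⟨Ku, hu₀⟩ := hu₀
  have hO : Bornology.IsBounded (thickening 1 Ω) := hΩ.thickening
  obtain ⟨Mf, hMf⟩ := exists_abs_uncurry_le hf hO
  obtain ⟨Mg, hMg⟩ := exists_abs_uncurry_le hg hO
  obtain ⟨Mu, hMu⟩ := LipschitzOnWith.exists_norm_le_real (hu₀.mono subset_closure) hΩ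
  obtain ⟨R, hR⟩ := Metric.isBounded_iff.1 hO
  set L : ℝ := Kf + Kg + Ku with hL
  have hLf : (Kf : ℝ) ≤ L := by rw [hL]; linarith [Kg.coe_nonneg, Ku.coe_nonneg]
  have hLg : (Kg : ℝ) ≤ L := by rw [hL]; linarith [Kf.coe_nonneg, Ku.coe_nonneg]
  have hLu : (Ku : ℝ) ≤ L := by rw [hL]; linarith [Kf.coe_nonneg, Kg.coe_nonneg]
  have hfx : ∀ x ∉ Ω, ∀ y ∉ Ω, |f x 0 - f y 0| ≤ L * dist x y := fun x hx y hy => by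
    simpa using hf.abs_uncurry_sub_le hLf (x := x) (y := y) hx hy ⟨le_rfl, hT⟩ ⟨le_rfl, hT⟩
  have hux : ∀ x ∈ closure Ω, ∀ y ∈ closure Ω, |u₀ x - u₀ y| ≤ L * dist x y :=
    fun x hx y hy => (hu₀.dist_le_mul x hx y hy).trans (by gcongr)
  have hmix : ∀ x ∈ Ω, ∀ y ∉ Ω, |u₀ x - f y 0| ≤ L * dist x y := by
    intro x hx y hy
    obtain ⟨p, hpf, hps⟩ := exists_mem_frontier_segment hx hy
    have hpΩ : p ∉ Ω := fun hp => by rw [hΩo.frontier_eq] at hpf; exact hpf.2 hp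
    rw [← dist_add_dist_of_mem_segment hps, mul_add]
    refine (abs_sub_le _ (u₀ p) _).trans (add_le_add ?_ ?_)
    · exact hux x (subset_closure hx) p (frontier_subset_closure hpf)
    · rw [hcompat p hpf]; exact hfx p hpΩ y hy
  refine ⟨L, max 0 (max Mf (max Mg Mu)), max R 0 + 1, by linarith [le_max_right R 0], hT,
    Kf.coe_nonneg.trans hLf, le_max_left _ _, ?_, ?_, ?_, ?_, ?_, ?_, ?_⟩
  · exact fun x hx y hy s hs t ht => hf.abs_uncurry_sub_le hLf hx hy hs ht
  · exact fun x hx y hy s hs t ht => hg.abs_uncurry_sub_le hLg hx hy hs ht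
  · intro x y
    unfold initialPayoff
    split_ifs with hx hy hy
    · exact hux x (subset_closure hx) y (subset_closure hy)
    · exact hmix x hx y hy
    · rw [abs_sub_comm, dist_comm]; exact hmix y hy x hx
    · exact hfx x hx y hy
  · exact fun x hx hx' t ht => (hMf x hx hx' t ht).trans (by simp)
  · exact fun x hx hx' t ht => (hMg x hx hx' t ht).trans (by simp)
  · exact fun x hx => (hMu x hx).trans (by simp)
  · intro x hx y hy
    linarith [hR hx hy, le_max_left R 0]

end Main

theorem theorem5p5 {N : ℕ} (hN : 0 < N)
    (Ω : Set (EuclideanSpace ℝ (Fin N)))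
    (hΩ_open : IsOpen Ω) (hΩ_conn : IsConnected Ω) (hΩ_bdd : Bornology.IsBounded Ω)
    (hΩ_sphere : UniformExteriorSphere Ω)
    (T : ℝ) (hT : 0 < T)
    (f g : EuclideanSpace ℝ (Fin N) → ℝ → ℝ) (u₀ : EuclideanSpace ℝ (Fin N) → ℝ)
    (hf : ∃ K, LipschitzOnWith K (fun p : EuclideanSpace ℝ (Fin N) × ℝ => f p.1 p.2)
      (Ωᶜ ×ˢ Icc 0 T))
    (hg : ∃ K, LipschitzOnWith K (fun p : EuclideanSpace ℝ (Fin N) × ℝ => g p.1 p.2)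
      (Ωᶜ ×ˢ Icc 0 T))
    (hu₀ : ∃ K, LipschitzOnWith K u₀ (closure Ω))
    (hcompat : ∀ x ∈ frontier Ω, u₀ x = f x 0)
    (uε vε : ℝ → EuclideanSpace ℝ (Fin N) → ℝ → ℝ)
    (hsol : ∀ ε ∈ Ioo (0 : ℝ) 1, IsDPPSolution Ω T f g u₀ ε (uε ε) (vε ε))
    (e : ℕ → ℝ) (he : ∀ n, e n ∈ Ioo (0 : ℝ) 1) (he_lim : Tendsto e atTop (𝓝 0)) :
    ∃ φ : ℕ → ℕ, StrictMono φ ∧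
      ∃ u v : EuclideanSpace ℝ (Fin N) × ℝ → ℝ,
        ContinuousOn u (closure Ω ×ˢ Icc 0 T) ∧
        ContinuousOn v (closure Ω ×ˢ Icc 0 T) ∧
        TendstoUniformlyOn (fun k p => uε (e (φ k)) p.1 p.2) u atTop
          (closure Ω ×ˢ Icc 0 T) ∧
        TendstoUniformlyOn (fun k p => vε (e (φ k)) p.1 p.2) v atTop
          (closure Ω ×ˢ Ioc 0 T) ∧
        ((∀ n, SolvesSecondBoardAt Ω g (e n) (uε (e n)) (vε (e n)) 0) →
          TendstoUniformlyOn (fun k p => vε (e (φ k)) p.1 p.2) v atTop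
            (closure Ω ×ˢ Icc 0 T)) := by
  obtain ⟨L, M, R, hR, hd⟩ := exists_dataBounds hΩ_open hΩ_bdd hT.le hf hg hu₀ hcompat
  have hS : IsCompact (closure Ω ×ˢ Icc 0 T) := hΩ_bdd.isCompact_closure.prod isCompact_Icc
  have hclo := closure_subset_thickening one_pos Ω
  have heq : ∀ η > 0, ∃ δ > 0, ∃ n₀, ∀ n ≥ n₀,
      ∀ x ∈ closure Ω, ∀ x' ∈ closure Ω, ∀ t ∈ Icc 0 T, ∀ t' ∈ Icc 0 T,
        dist x x' ≤ δ → |t - t'| ≤ δ →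
        |uε (e n) x t - uε (e n) x' t'| ≤ η ∧
        (SolvesSecondBoardAt Ω g (e n) (uε (e n)) (vε (e n)) t →
          SolvesSecondBoardAt Ω g (e n) (uε (e n)) (vε (e n)) t' →
          |vε (e n) x t - vε (e n) x' t'| ≤ η) := by
    intro η hη
    obtain ⟨δ, hδ, ε₀, hε₀, H⟩ := IsDPPSolution.asymptotically_equicontinuous hN hΩ_open hΩ_bdd
      hΩ_sphere hd hR hη
    obtain ⟨n₀, hn₀⟩ := eventually_atTop.1 (he_lim.eventually (gt_mem_nhds hε₀))
    exact ⟨δ, hδ, n₀, fun n hn => H (e n) _ _ ⟨(he n).1, hn₀ n hn⟩ (hsol _ (he n))⟩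
  obtain ⟨φ₁, hφ₁, u, hu, hulim⟩ := exists_subseq_tendstoUniformlyOn hS
    (F := fun n p => uε (e n) p.1 p.2) (M := M)
    (fun n p hp => (hsol _ (he n)).first_abs_le hd hΩ_bdd (he n) _ hp.2.2 _ (hclo hp.1)) (by
      intro η hη
      obtain ⟨δ, hδ, n₀, H⟩ := heq η hη
      refine ⟨δ, hδ, n₀, fun n hn p hp q hq hpq => ?_⟩
      rw [Prod.dist_eq, max_lt_iff] at hpq
      exact (H n hn _ hp.1 _ hq.1 _ hp.2 _ hq.2 hpq.1.le hpq.2.le).1)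
  -- at times close to `0` the functions `v` are replaced by their values at the time `τ n > 0`
  set τ : ℕ → ℝ := fun n => T / (n + 1) with hτ
  have hτ0 : ∀ n, 0 < τ n := fun n => by positivity
  have hτT : ∀ n, τ n ≤ T := fun n => div_le_self hT.le (by simp)
  have hτlim : Tendsto τ atTop (𝓝 0) := by
    have := (tendsto_one_div_add_atTop_nhds_zero_nat (𝕜 := ℝ)).const_mul T
    simpa [hτ, div_eq_mul_inv] using this
  have hmaxmem : ∀ n, ∀ t ∈ Icc 0 T, max t (τ n) ∈ Ioc 0 T := fun n t ht =>
    ⟨lt_max_of_lt_right (hτ0 n), max_le ht.2 (hτT n)⟩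
  obtain ⟨φ₂, hφ₂, v, hv, hvlim⟩ := exists_subseq_tendstoUniformlyOn hS
    (F := fun n p => vε (e (φ₁ n)) p.1 (max p.2 (τ n))) (M := M)
    (fun n p hp => (hsol _ (he _)).second_abs_le hd hΩ_bdd (he _) (hmaxmem n _ hp.2) _
      (hclo hp.1)) (by
      intro η hη
      obtain ⟨δ, hδ, n₀, H⟩ := heq η hη
      refine ⟨δ, hδ, n₀, fun n hn p hp q hq hpq => ?_⟩
      rw [Prod.dist_eq, max_lt_iff] at hpq
      have hp' := hmaxmem n _ hp.2
      have hq' := hmaxmem n _ hq.2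
      exact (H _ (hn.trans (hφ₁.id_le n)) _ hp.1 _ hq.1 _ (Ioc_subset_Icc_self hp') _
        (Ioc_subset_Icc_self hq') hpq.1.le ((abs_max_sub_max_le_abs _ _ _).trans hpq.2.le)).2
        ((hsol _ (he _)).secondBoard _ hp') ((hsol _ (he _)).secondBoard _ hq'))
  -- the replacement is harmless on every set of times where the second-board relations hold
  have hvJ : ∀ J ⊆ Icc 0 T,
      (∀ n, ∀ t ∈ J, SolvesSecondBoardAt Ω g (e n) (uε (e n)) (vε (e n)) t) →
      TendstoUniformlyOn (fun k p => vε (e (φ₁ (φ₂ k))) p.1 p.2) v atTop (closure Ω ×ˢ J) := by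
    intro J hJ hsecond
    rw [Metric.tendstoUniformlyOn_iff] at hvlim ⊢
    intro η hη
    obtain ⟨δ, hδ, n₀, H⟩ := heq (η / 2) (by positivity)
    filter_upwards [hvlim (η / 2) (by positivity), eventually_ge_atTop n₀,
      (hτlim.comp hφ₂.tendsto_atTop).eventually (ge_mem_nhds hδ)] with k h1 h2 h3 p hp
    have hp' := hmaxmem (φ₂ k) _ (hJ hp.2)
    have hn : n₀ ≤ φ₁ (φ₂ k) := h2.trans ((hφ₂.id_le k).trans (hφ₁.id_le _))
    have h4 : |max p.2 (τ (φ₂ k)) - p.2| ≤ δ := by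
      have h5 : 0 ≤ p.2 := (hJ hp.2).1
      have h6 : τ (φ₂ k) ≤ δ := h3
      rw [abs_of_nonneg (sub_nonneg.2 (le_max_left _ _)), sub_le_iff_le_add]
      exact max_le (by linarith) (by linarith)
    have h5 := (H _ hn p.1 hp.1 p.1 hp.1 _ (Ioc_subset_Icc_self hp') _ (hJ hp.2)
      (by rw [dist_self]; exact hδ.le) h4).2
      ((hsol _ (he _)).secondBoard _ hp') (hsecond _ _ hp.2)
    have h6 := h1 p ⟨hp.1, hJ hp.2⟩
    rw [← Real.dist_eq] at h5
    linarith [dist_triangle (v p) (vε (e (φ₁ (φ₂ k))) p.1 (max p.2 (τ (φ₂ k))))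
      (vε (e (φ₁ (φ₂ k))) p.1 p.2)]
  refine ⟨φ₁ ∘ φ₂, hφ₁.comp hφ₂, u, v, hu, hv, ?_, ?_, fun h0 => ?_⟩
  · rw [Metric.tendstoUniformlyOn_iff] at hulim ⊢
    exact fun η hη => hφ₂.tendsto_atTop.eventually (hulim η hη)
  · exact hvJ _ Ioc_subset_Icc_self fun n t ht => (hsol _ (he n)).secondBoard t ht
  · refine hvJ _ subset_rfl fun n t ht => ?_
    rcases ht.1.eq_or_lt with rfl | h
    · exact h0 n
    · exact (hsol _ (he n)).secondBoard t ⟨h, ht.2⟩
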